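/- A transformation group $(G,X)$ is a compact Hausdorff space $X$ together with a discrete group $G$ acting continuously on $X$. A nonempty subset $Y\subseteq X$ is invariant if $GY\subseteq Y$. For a closed invariant subset $Y$ of $(G,X)$, the height is $$h(G,Y)=\sup\{n\ge 0:\text{ there exist distinct closed invariant subsets } Y_0\subset Y_1\subset\cdots\subset Y_n=Y \text{ of } (G,X)\}\in\{0,1,2,\ldots\}\cup\{+\infty\}.$$ Let $\mathrm{Homeo}(X)$ be the group of all homeomorphisms $X\to X$ (with the discrete topology), and let $$P_h(X)=\{h(G,X) : (G,X)\text{ is a transformation group}\}.$$ A topological graph is a compact connected metrizable space that is a finite union of arcs (subspaces homeomorphic to $[0,1]$, whose end points are the points corresponding to $0$ and $1$), any two distinct ones of which intersect at most in their end points, that is, every common point of two distinct arcs is an end point of both. Theorem. For every topological graph $X$ we have $h(\mathrm{Homeo}(X),X)<+\infty$ and $$P_h(X)=\{h(\mathrm{Homeo}(X),X),\,h(\mathrm{Homeo}(X),X)+1,\,h(\mathrm{Homeo}(X),X)+2,\ldots\}\cup\{+\infty\}.$$ -/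

import Mathlib

universe u v

namespace TransformationGroup

/-- The full homeomorphism group of `X` acts on `X` by evaluation. -/
instance homeoMulAction (X : Type u) [TopologicalSpace X] : MulAction (X ≃ₜ X) X where
  smul f x := f x
  one_smul _ := rfl
  mul_smul _ _ _ := rfl

/-- A closed invariant subset of the transformation group `(G, X)`; invariant sets are nonempty. -/
structure IsClosedInvariant (G : Type v) {X : Type u} [TopologicalSpace X] [Group G]
    [MulAction G X] (Y : Set X) : Prop where
  nonempty : Y.Nonempty
  isClosed : IsClosed Y
  smul_mem : ∀ (g : G), ∀ y ∈ Y, g • y ∈ Y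

/-- The height `h(G, Y)`: the supremum in `ℕ ∪ {+∞}` of all `n` for which there is a chain
`Z 0 ⊂ Z 1 ⊂ ⋯ ⊂ Z n = Y` of distinct closed invariant subsets of `(G, X)`. -/
noncomputable def height (G : Type v) {X : Type u} [TopologicalSpace X] [Group G]
    [MulAction G X] (Y : Set X) : ℕ∞ :=
  sSup {m : ℕ∞ | ∃ (n : ℕ) (Z : Fin (n + 1) → Set X),
    m = n ∧ StrictMono Z ∧ (∀ i, IsClosedInvariant G (Z i)) ∧ Z (Fin.last n) = Y}

/-- The set `P_h(X)` of all heights `h(G, X)` of transformation groups `(G, X)`, where `G` is a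
discrete group acting continuously on `X`. The groups range over the universe of `X`; this is no
restriction, see `height_mem_possibleHeights`. -/
def possibleHeights (X : Type u) [TopologicalSpace X] : Set ℕ∞ :=
  {h | ∃ (G : Type u) (_ : Group G) (_ : TopologicalSpace G) (_ : DiscreteTopology G)
    (_ : MulAction G X) (_ : ContinuousSMul G X), h = height G (Set.univ : Set X)}

theorem height_congr {G : Type v} {H : Type*} {X : Type u} [TopologicalSpace X] [Group G]
    [MulAction G X] [Group H] [MulAction H X]
    (h₁ : ∀ g : G, ∃ k : H, ∀ x : X, k • x = g • x)
    (h₂ : ∀ k : H, ∃ g : G, ∀ x : X, g • x = k • x) (Y : Set X) :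
    height G Y = height H Y := by
  have key : ∀ S : Set X, IsClosedInvariant G S ↔ IsClosedInvariant H S := by
    intro S
    constructor
    · rintro ⟨a, b, c⟩
      refine ⟨a, b, fun k y hy => ?_⟩
      obtain ⟨g, hg⟩ := h₂ k
      exact hg y ▸ c g y hy
    · rintro ⟨a, b, c⟩
      refine ⟨a, b, fun g y hy => ?_⟩
      obtain ⟨k, hk⟩ := h₁ g
      exact hk y ▸ c k y hy
  simp only [height, key]

/-- `P_h(X)` is also the set of heights of subgroups of the homeomorphism group of `X`. -/
theorem mem_possibleHeights_iff {X : Type u} [TopologicalSpace X] {h : ℕ∞} :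
    h ∈ possibleHeights X ↔
      ∃ H : Subgroup (X ≃ₜ X), h = height H (Set.univ : Set X) := by
  constructor
  · rintro ⟨G, _, _, _, _, _, rfl⟩
    let φ : G →* (X ≃ₜ X) :=
      { toFun := fun g => Homeomorph.smul g
        map_one' := by ext x; exact one_smul G x
        map_mul' := fun a b => by ext x; exact mul_smul a b x }
    refine ⟨φ.range, height_congr (fun g => ⟨⟨φ g, g, rfl⟩, fun x => rfl⟩) ?_ _⟩
    rintro ⟨_, g, rfl⟩
    exact ⟨g, fun x => rfl⟩
  · rintro ⟨H, rfl⟩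
    letI : TopologicalSpace H := ⊥
    haveI : DiscreteTopology H := ⟨rfl⟩
    haveI : ContinuousSMul H X :=
      ⟨continuous_prod_of_discrete_left.2 fun f => f.1.continuous⟩
    exact ⟨H, inferInstance, inferInstance, inferInstance, inferInstance, inferInstance, rfl⟩

/-- Transformation groups `(G, X)` with `G` in an arbitrary universe give no further heights. -/
theorem height_mem_possibleHeights (G : Type v) (X : Type u) [TopologicalSpace X] [Group G]
    [TopologicalSpace G] [MulAction G X] [ContinuousSMul G X] :
    height G (Set.univ : Set X) ∈ possibleHeights X := by
  let φ : G →* (X ≃ₜ X) :=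
    { toFun := fun g => Homeomorph.smul g
      map_one' := by ext x; exact one_smul G x
      map_mul' := fun a b => by ext x; exact mul_smul a b x }
  refine mem_possibleHeights_iff.2
    ⟨φ.range, height_congr (fun g => ⟨⟨φ g, g, rfl⟩, fun x => rfl⟩) ?_ _⟩
  rintro ⟨_, g, rfl⟩
  exact ⟨g, fun x => rfl⟩

/-- `A` is an arc in `X` (a subspace homeomorphic to `[0,1]`) with end points `a` and `b`. -/
def IsArc {X : Type u} [TopologicalSpace X] (A : Set X) (a b : X) : Prop :=
  ∃ φ : unitInterval ≃ₜ A, (φ 0 : X) = a ∧ (φ 1 : X) = b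

/-- A topological graph: a compact connected (in particular nonempty) metrizable space that is a
finite union of arcs, any two of which meet at most in their end points. -/
structure IsTopologicalGraph (X : Type u) [TopologicalSpace X] : Prop where
  compactSpace : CompactSpace X
  connectedSpace : ConnectedSpace X
  metrizableSpace : TopologicalSpace.MetrizableSpace X
  exists_arcs : ∃ (n : ℕ) (A : Fin n → Set X) (a b : Fin n → X),
    (∀ i, IsArc (A i) (a i) (b i)) ∧ (⋃ i, A i) = Set.univ ∧
    ∀ i j, i ≠ j → A i ∩ A j ⊆ {a i, b i} ∩ {a j, b j}

end TransformationGroup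

namespace TransformationGroup

open Set Filter Topology

/-! Every closed set invariant under all homeomorphisms is invariant under any acting group, so the
height of `X ≃ₜ X` is a lower bound (`height_le_height`), and the trivial group on an infinite space
has height `⊤`. What remains is that the lower bound is finite and that each `k` can be added to it
by passing to a suitable subgroup.

Heights are computed by counting orbits. If there are finitely many orbits and invariant open sets
separate them, the orbit space is a finite T₀ space. There a maximal chain of nonempty closed sets
gains one point at each step, so the height is the number of orbits minus one
(`height_add_one_eq_card`).

Cut the graph into finitely many vertices and open edges, each parametrized by `ℝ`. A vertex with a
line neighbourhood is the end of exactly two half edges. If these belong to different edges, the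
edges are merged and the vertex disappears; if they belong to one edge, connectedness makes `X` a
circle (`IsDecomp.exists_normal_form`). Outside the circle case all remaining vertices are singular,
so every homeomorphism preserves `V`, and the group `K` preserving `V` is the full group. It has
finitely many orbits.

To add `k`, mark the edges in the `K`-orbit of one edge with `nestedRank k`. This function has
levels `0, …, k`, open lower level sets, and enough rank preserving order automorphisms to be
transitive on each level. It is even, so homeomorphisms that reverse edges can be straightened to
preserve it (`exists_straighten`). The rank preserving subgroup of `K` splits one `K`-orbit into `k
+ 1` orbits and leaves the others intact (`height_preserving_rank`), which raises the height by
exactly `k`.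

The circle is homogeneous and has height `0`, while the stabilizer of a point has height `1`. There
the value `0` comes from the full group and all larger ones from subgroups of the stabilizer. -/

/-! ### Heights and orbit counting -/

theorem le_height {G : Type v} {X : Type u} [TopologicalSpace X] [Group G] [MulAction G X]
    {n : ℕ} (Z : Fin (n + 1) → Set X) (hZ : StrictMono Z) (hinv : ∀ i, IsClosedInvariant G (Z i))
    {Y : Set X} (hY : Z (Fin.last n) = Y) : (n : ℕ∞) ≤ height G Y :=
  le_sSup ⟨n, Z, rfl, hZ, hinv, hY⟩

/-- Passing to a smaller group can only increase the height. -/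
theorem height_le_height {G H : Type*} {X : Type u} [TopologicalSpace X] [Group G]
    [MulAction G X] [Group H] [MulAction H X] (h : ∀ k : H, ∃ g : G, ∀ x : X, g • x = k • x)
    (Y : Set X) : height G Y ≤ height H Y := by
  refine sSup_le ?_
  rintro _ ⟨n, Z, rfl, hZ, hinv, hY⟩
  refine le_height Z hZ (fun i => ⟨(hinv i).1, (hinv i).2, fun k y hy => ?_⟩) hY
  obtain ⟨g, hg⟩ := h k
  exact hg y ▸ (hinv i).3 g y hy

/-- The trivial group on an infinite space has infinite height. -/
theorem height_eq_top_of_trivial {G : Type v} {X : Type u} [TopologicalSpace X] [T1Space X]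
    [Infinite X] [Group G] [MulAction G X] (h : ∀ (g : G) (x : X), g • x = x) :
    height G (univ : Set X) = ⊤ := by
  refine ENat.eq_top_iff_forall_ge.2 fun n => ?_
  let f := Infinite.natEmbedding X
  -- Growing finite sets are closed in a T₁ space; the last member is replaced by the whole space
  -- because a chain must end there.
  let Z : Fin (n + 1) → Set X := fun i => if i = Fin.last n then univ else f '' Iic (i : ℕ)
  refine le_height Z ?_ ?_ (if_pos rfl)
  · intro i j hij
    have hi : i ≠ Fin.last n := (hij.trans_le (Fin.le_last j)).ne
    have hj : f '' Iic (j : ℕ) ⊆ Z j := by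
      by_cases h : j = Fin.last n <;> simp [Z, h]
    have hi' : Z i = f '' Iic (i : ℕ) := if_neg hi
    rw [hi']
    refine (ssubset_iff_subset_ne.2 ⟨?_, fun he => ?_⟩ :
      f '' Iic (i : ℕ) ⊂ f '' Iic (j : ℕ)).trans_subset hj
    · exact image_mono (Iic_subset_Iic.2 hij.le)
    · have := (f.injective.image_injective he).symm
      have h2 : (j : ℕ) ∈ Iic (i : ℕ) := this ▸ mem_Iic.2 le_rfl
      exact absurd hij (not_lt.2 (Fin.le_def.2 h2))
  · intro i
    refine ⟨?_, ?_, fun g y hy => (h g y).symm ▸ hy⟩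
    · by_cases hi : i = Fin.last n
      · simp [Z, hi]
      · simp only [Z, hi, if_false]
        exact ⟨f 0, 0, by simp, rfl⟩
    · by_cases hi : i = Fin.last n
      · simp [Z, hi]
      · simp only [Z, hi, if_false]
        exact ((finite_Iic _).image f).isClosed

/-- A nonempty closed subset with `n + 1` points of a finite `T₀` space is the top of a chain of
`n + 1` nonempty closed sets. -/
theorem exists_closed_chain {Q : Type*} [TopologicalSpace Q] [T0Space Q] [Finite Q] (n : ℕ)
    (S : Set Q) (hS : IsClosed S) (hn : S.ncard = n + 1) :
    ∃ Z : ℕ → Set Q, (∀ i < n, Z i ⊂ Z (i + 1)) ∧ (∀ i, (Z i).Nonempty ∧ IsClosed (Z i)) ∧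
      Z n = S := by
  induction n generalizing S with
  | zero =>
    refine ⟨fun _ => S, by simp, fun _ => ⟨?_, hS⟩, rfl⟩
    exact (ncard_pos (toFinite S)).1 (by omega)
  | succ n ih =>
    have hne : S.Nonempty := (ncard_pos (toFinite S)).1 (by omega)
    have : Nonempty S := hne.to_subtype
    -- A nonempty finite T₀ space has an open point; removing it leaves a closed set with one point
    -- fewer.
    obtain ⟨x, hx⟩ := exists_open_singleton_of_finite (X := S)
    obtain ⟨U, hU, hUx⟩ := isOpen_induced_iff.1 hx
    have hxS : (x : Q) ∈ S := x.2
    have hd : S \ U = S \ {(x : Q)} := by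
      ext y
      constructor
      · rintro ⟨hy, hyU⟩
        refine ⟨hy, fun hyx => hyU ?_⟩
        rw [mem_singleton_iff.1 hyx]
        exact (hUx ▸ mem_singleton x : x ∈ Subtype.val ⁻¹' U)
      · rintro ⟨hy, hyx⟩
        refine ⟨hy, fun hyU => hyx ?_⟩
        have : (⟨y, hy⟩ : S) ∈ Subtype.val ⁻¹' U := hyU
        rw [hUx] at this
        exact congrArg Subtype.val (mem_singleton_iff.1 this)
    have hcl : IsClosed (S \ {(x : Q)}) := hd ▸ hS.sdiff hU
    have hc : (S \ {(x : Q)}).ncard = n + 1 := by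
      rw [ncard_sdiff_singleton_of_mem hxS]; omega
    obtain ⟨Z, hZ, hZ', hZn⟩ := ih _ hcl hc
    refine ⟨fun i => if i ≤ n then Z i else S, fun i hi => ?_, fun i => ?_, by simp⟩
    · rcases Nat.lt_succ_iff_lt_or_eq.1 hi with h | rfl
      · simpa [h.le, Nat.succ_le_of_lt h] using hZ i h
      · simp only [le_refl, if_true, Nat.not_succ_le_self, if_false, hZn]
        exact sdiff_singleton_ssubset.2 hxS
    · by_cases h : i ≤ n
      · simpa [h] using hZ' i
      · simpa [h] using ⟨hne, hS⟩

/-- If there are finitely many orbits and any two of them are separated by an invariant open set,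
then the height is one less than the number of orbits. -/
theorem height_add_one_eq_card {G : Type v} {X : Type u} [TopologicalSpace X] [Group G]
    [MulAction G X] [Nonempty X] [Finite (MulAction.orbitRel.Quotient G X)]
    (hsep : ∀ x y : X, x ∉ MulAction.orbit G y → ∃ U : Set X, IsOpen U ∧
      (∀ (g : G), ∀ z ∈ U, g • z ∈ U) ∧ ¬ (x ∈ U ↔ y ∈ U)) :
    height G (univ : Set X) + 1 = Nat.card (MulAction.orbitRel.Quotient G X) := by
  let Q := MulAction.orbitRel.Quotient G X
  let : TopologicalSpace Q := inferInstanceAs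
    (TopologicalSpace (Quotient (MulAction.orbitRel G X)))
  let π : X → Q := Quotient.mk _
  have hπ : Function.Surjective π := Quotient.mk_surjective
  have hπe : ∀ x y, π x = π y ↔ x ∈ MulAction.orbit G y := fun x y => Quotient.eq
  have hsmul : ∀ (g : G) x, π (g • x) = π x := fun g x => (hπe _ _).2 ⟨g, rfl⟩
  -- Invariant sets are saturated, so they correspond to subsets of the orbit space, and open ones
  -- to open ones.
  have hsat : ∀ (U : Set X), (∀ (g : G), ∀ z ∈ U, g • z ∈ U) → π ⁻¹' (π '' U) = U := by
    intro U hU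
    refine Subset.antisymm ?_ (subset_preimage_image _ _)
    rintro x ⟨y, hy, hxy⟩
    obtain ⟨g, rfl⟩ := (hπe _ _).1 hxy.symm
    exact hU g y hy
  have hqm : Topology.IsQuotientMap π := isQuotientMap_quot_mk
  have : T0Space Q := by
    refine ⟨fun p q hpq => ?_⟩
    obtain ⟨x, rfl⟩ := hπ p
    obtain ⟨y, rfl⟩ := hπ q
    by_contra hne
    obtain ⟨U, hU, hinv, hxy⟩ := hsep x y (fun h => hne ((hπe x y).2 h))
    refine hxy ?_
    have hUo : IsOpen (π '' U) := hqm.isOpen_preimage.1 ((hsat U hinv).symm ▸ hU)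
    have := hpq.mem_open_iff hUo
    rw [← mem_preimage, ← mem_preimage (a := y), hsat U hinv] at this
    exact this
  have : Nonempty Q := ‹Nonempty X›.map π
  obtain ⟨N, hN⟩ : ∃ N, Nat.card Q = N + 1 :=
    Nat.exists_eq_succ_of_ne_zero Nat.card_pos.ne'
  have hle : height G (univ : Set X) ≤ N := by
    refine sSup_le ?_
    rintro _ ⟨n, Z, rfl, hZ, hinv, -⟩
    -- Along a chain the number of orbits strictly increases and lies between `1` and `N + 1`, which
    -- leaves room for at most `N` steps.
    have hmono : StrictMono fun i => (π '' Z i).ncard := by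
      intro i j hij
      refine ncard_lt_ncard (ssubset_iff_subset_ne.2 ⟨image_mono (hZ hij).subset, fun he => ?_⟩)
        (toFinite _)
      have h2 : π ⁻¹' (π '' Z i) = π ⁻¹' (π '' Z j) := congrArg _ he
      rw [hsat _ (hinv i).3, hsat _ (hinv j).3] at h2
      exact (hZ hij).ne h2
    have hcard := Finset.card_le_card_of_injOn (s := (Finset.univ : Finset (Fin (n + 1))))
      (t := Finset.Icc 1 (N + 1)) (fun i => (π '' Z i).ncard) (fun i _ => ?_)
      hmono.injective.injOn
    · simp only [Finset.card_univ, Fintype.card_fin, Nat.card_Icc] at hcard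
      exact_mod_cast (by omega : n ≤ N)
    · refine Finset.mem_coe.2 (Finset.mem_Icc.2 ⟨?_, ?_⟩)
      · exact (ncard_pos (toFinite _)).2 ((hinv i).1.image π)
      · exact hN ▸ ncard_le_card _
  have hge : (N : ℕ∞) ≤ height G (univ : Set X) := by
    obtain ⟨Z, hZ, hZ', hZn⟩ := exists_closed_chain N (univ : Set Q) isClosed_univ
      (by rw [ncard_univ, hN])
    refine le_height (fun i : Fin (N + 1) => π ⁻¹' Z i) ?_ (fun i => ⟨?_, ?_, ?_⟩) ?_
    · refine Fin.strictMono_iff_lt_succ.2 fun i => ?_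
      have := hZ i i.2
      exact ssubset_iff_subset_ne.2 ⟨preimage_mono this.subset, fun he =>
        this.ne (hπ.preimage_injective he)⟩
    · exact (hZ' i).1.preimage hπ
    · exact (hZ' i).2.preimage hqm.continuous
    · intro g y hy
      change π (g • y) ∈ Z i
      rw [hsmul]; exact hy
    · simp [hZn]
  rw [le_antisymm hle hge]
  change _ = ((Nat.card Q : ℕ) : ℕ∞)
  rw [hN]; rfl

/-! ### Nested ranks on the real line -/

/-- The inverse of the sigmoid function on `(0, 1)`. -/
noncomputable def logit : ℝ → ℝ := Function.invFun Real.sigmoid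

@[simp] theorem logit_sigmoid (x : ℝ) : logit (Real.sigmoid x) = x :=
  Function.leftInverse_invFun Real.sigmoid_injective x

theorem sigmoid_logit {t : ℝ} (ht : t ∈ Ioo (0 : ℝ) 1) : Real.sigmoid (logit t) = t := by
  rw [← Real.range_sigmoid] at ht
  exact Function.invFun_eq ht

theorem sigmoid_mem (x : ℝ) : Real.sigmoid x ∈ Ioo (0 : ℝ) 1 :=
  ⟨Real.sigmoid_pos x, Real.sigmoid_lt_one x⟩

/-- The order automorphism of `ℝ` acting on `(0, 1)` as a conjugate of `c`, and trivially
elsewhere. -/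
theorem exists_orderIso_unit (c : ℝ ≃o ℝ) : ∃ d : ℝ ≃o ℝ,
    (∀ x, d (Real.sigmoid x) = Real.sigmoid (c x)) ∧ ∀ x ∉ Ioo (0 : ℝ) 1, d x = x := by
  classical
  let f : (ℝ ≃o ℝ) → ℝ → ℝ := fun c x =>
    if x ∈ Ioo (0 : ℝ) 1 then Real.sigmoid (c (logit x)) else x
  have f1 : ∀ c x, f c (Real.sigmoid x) = Real.sigmoid (c x) := fun c x => by
    simp only [f, if_pos (sigmoid_mem x), logit_sigmoid]
  have f2 : ∀ c, ∀ x ∉ Ioo (0 : ℝ) 1, f c x = x := fun c x hx => if_neg hx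
  have finv : ∀ c x, f c.symm (f c x) = x := by
    intro c x
    by_cases hx : x ∈ Ioo (0 : ℝ) 1
    · rw [← sigmoid_logit hx, f1, f1, c.symm_apply_apply]
    · rw [f2 _ _ hx, f2 _ _ hx]
  have fmono : ∀ c, StrictMono (f c) := by
    intro c x y hxy
    by_cases hx : x ∈ Ioo (0 : ℝ) 1 <;> by_cases hy : y ∈ Ioo (0 : ℝ) 1
    · rw [← sigmoid_logit hx, ← sigmoid_logit hy] at hxy ⊢
      rw [f1, f1]
      exact Real.sigmoid_lt (c.strictMono (Real.sigmoid_lt_iff.1 hxy))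
    · rw [f2 _ _ hy, ← sigmoid_logit hx, f1]
      have : 1 ≤ y := by
        by_contra h
        exact hy ⟨hx.1.trans hxy, not_le.1 h⟩
      exact (sigmoid_mem _).2.trans_le this
    · rw [f2 _ _ hx, ← sigmoid_logit hy, f1]
      have : x ≤ 0 := by
        by_contra h
        exact hx ⟨not_le.1 h, hxy.trans hy.2⟩
      exact this.trans_lt (sigmoid_mem _).1
    · rwa [f2 _ _ hx, f2 _ _ hy]
  refine ⟨StrictMono.orderIsoOfRightInverse (f c) (fmono c) (f c.symm) fun x => ?_, f1 c, f2 c⟩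
  exact finv c.symm x

/-- A function on `ℝ` with values `0, …, k` whose upper level sets form a nested family of closed
sets, the set of level `j` accumulating only at higher levels. -/
noncomputable def nestedRank : ℕ → ℝ → ℕ
  | 0, _ => 0
  | k + 1, x => open Classical in
    if Int.fract x = 0 then k + 1 else nestedRank k (logit (Int.fract x))

theorem nestedRank_succ_int (k : ℕ) (n : ℤ) : nestedRank (k + 1) n = k + 1 := by
  simp [nestedRank]

theorem nestedRank_succ_add (k : ℕ) (n : ℤ) (x : ℝ) :
    nestedRank (k + 1) (x + n) = nestedRank (k + 1) x := by
  simp [nestedRank]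

theorem nestedRank_succ_sigmoid (k : ℕ) (x : ℝ) :
    nestedRank (k + 1) (Real.sigmoid x) = nestedRank k x := by
  have h : Int.fract (Real.sigmoid x) = Real.sigmoid x :=
    Int.fract_eq_self.2 ⟨(sigmoid_mem x).1.le, (sigmoid_mem x).2⟩
  simp only [nestedRank, h, (sigmoid_mem x).1.ne', if_false, logit_sigmoid]

/-- This is the case distinction behind the recursion of `nestedRank`: integers get the top rank,
and each gap between consecutive integers is a copy of `ℝ` carrying the previous rank. -/
theorem eq_int_or_eq_sigmoid_add (x : ℝ) :
    (∃ n : ℤ, x = n) ∨ ∃ (y : ℝ) (n : ℤ), x = Real.sigmoid y + n := by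
  by_cases h : Int.fract x = 0
  · left
    exact ⟨⌊x⌋, by rw [← Int.self_sub_floor, sub_eq_zero] at h; exact h⟩
  · right
    have : Int.fract x ∈ Ioo (0 : ℝ) 1 :=
      ⟨lt_of_le_of_ne (Int.fract_nonneg x) (Ne.symm h), Int.fract_lt_one x⟩
    exact ⟨logit (Int.fract x), ⌊x⌋, by rw [sigmoid_logit this, Int.fract_add_floor]⟩

theorem nestedRank_le (k : ℕ) (x : ℝ) : nestedRank k x ≤ k := by
  induction k generalizing x with
  | zero => simp [nestedRank]
  | succ k ih =>
    rcases eq_int_or_eq_sigmoid_add x with ⟨n, rfl⟩ | ⟨y, n, rfl⟩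
    · rw [nestedRank_succ_int]
    · rw [nestedRank_succ_add, nestedRank_succ_sigmoid]
      exact (ih y).trans (Nat.le_succ k)

theorem exists_nestedRank_eq {k j : ℕ} (h : j ≤ k) : ∃ x, nestedRank k x = j := by
  induction k with
  | zero => exact ⟨0, by simp [nestedRank]; omega⟩
  | succ k ih =>
    rcases Nat.le_succ_iff.1 h with h | rfl
    · obtain ⟨x, hx⟩ := ih h
      exact ⟨Real.sigmoid x, by rw [nestedRank_succ_sigmoid, hx]⟩
    · exact ⟨(0 : ℤ), nestedRank_succ_int k 0⟩

/-- Evenness makes the rank of a point on an edge independent of the orientation of the edge.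
Reflection preserves the integers, and inside the gaps it is again a reflection because `sigmoid
(-y) = 1 - sigmoid y`. -/
theorem nestedRank_neg (k : ℕ) (x : ℝ) : nestedRank k (-x) = nestedRank k x := by
  induction k generalizing x with
  | zero => simp [nestedRank]
  | succ k ih =>
    rcases eq_int_or_eq_sigmoid_add x with ⟨n, rfl⟩ | ⟨y, n, rfl⟩
    · rw [← Int.cast_neg, nestedRank_succ_int, nestedRank_succ_int]
    · have : -(Real.sigmoid y + n) = Real.sigmoid (-y) + ((-1 - n : ℤ) : ℝ) := by
        rw [Real.sigmoid_neg]; push_cast; ring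
      rw [this, nestedRank_succ_add, nestedRank_succ_add, nestedRank_succ_sigmoid,
        nestedRank_succ_sigmoid, ih]

/-- A proper lower level set misses the integers, which have the top rank, and is therefore a union
of copies, one in each gap, of an open set from the previous stage. -/
theorem isOpen_nestedRank_le (k j : ℕ) : IsOpen {x | nestedRank k x ≤ j} := by
  induction k with
  | zero => simp [nestedRank]
  | succ k ih =>
    by_cases hj : k + 1 ≤ j
    · convert isOpen_univ
      ext x
      simp [(nestedRank_le (k + 1) x).trans hj]
    · have hse : IsOpenEmbedding Real.sigmoid :=
        ⟨Real.sigmoid_strictMono.isEmbedding_of_ordConnected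
          (by rw [Real.range_sigmoid]; exact ordConnected_Ioo),
          by rw [Real.range_sigmoid]; exact isOpen_Ioo⟩
      have : {x | nestedRank (k + 1) x ≤ j} =
          ⋃ n : ℤ, (fun x : ℝ => x + n) '' (Real.sigmoid '' {x | nestedRank k x ≤ j}) := by
        ext x
        simp only [mem_ofPred_eq, mem_iUnion, mem_image, exists_exists_and_eq_and]
        constructor
        · intro hx
          rcases eq_int_or_eq_sigmoid_add x with ⟨n, rfl⟩ | ⟨y, n, rfl⟩
          · rw [nestedRank_succ_int] at hx; exact absurd hx hj
          · rw [nestedRank_succ_add, nestedRank_succ_sigmoid] at hx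
            exact ⟨n, y, hx, rfl⟩
        · rintro ⟨n, y, hy, rfl⟩
          rwa [nestedRank_succ_add, nestedRank_succ_sigmoid]
      rw [this]
      exact isOpen_iUnion fun n => (Homeomorph.addRight (n : ℝ)).isOpenMap _ (hse.isOpenMap _ ih)

/-- Order automorphisms preserving `nestedRank k` act transitively on its level sets. -/
theorem exists_orderIso_nestedRank {k : ℕ} {x y : ℝ} (h : nestedRank k x = nestedRank k y) :
    ∃ c : ℝ ≃o ℝ, (∀ t, nestedRank k (c t) = nestedRank k t) ∧ c x = y := by
  induction k generalizing x y with
  | zero => exact ⟨OrderIso.addRight (y - x), fun t => rfl, by simp⟩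
  | succ k ih =>
    rcases eq_int_or_eq_sigmoid_add x with ⟨n, rfl⟩ | ⟨a, n, rfl⟩ <;>
    rcases eq_int_or_eq_sigmoid_add y with ⟨m, rfl⟩ | ⟨b, m, rfl⟩
    · refine ⟨OrderIso.addRight ((m - n : ℤ) : ℝ), fun t => nestedRank_succ_add _ _ _, ?_⟩
      simp
    · rw [nestedRank_succ_int, nestedRank_succ_add, nestedRank_succ_sigmoid] at h
      have := nestedRank_le k b; omega
    · rw [nestedRank_succ_int, nestedRank_succ_add, nestedRank_succ_sigmoid] at h
      have := nestedRank_le k a; omega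
    · rw [nestedRank_succ_add, nestedRank_succ_add, nestedRank_succ_sigmoid,
        nestedRank_succ_sigmoid] at h
      obtain ⟨c, hc, hab⟩ := ih h
      obtain ⟨d, hd, hd'⟩ := exists_orderIso_unit c
      -- Shift the gap `(n, n + 1)` to `(0, 1)`, move the point there by the conjugate of `c`, and
      -- shift on to `(m, m + 1)`. All other gaps are only translated by an integer.
      refine ⟨(OrderIso.addRight (-(n : ℝ))).trans (d.trans (OrderIso.addRight (m : ℝ))),
        fun t => ?_, ?_⟩
      · change nestedRank (k + 1) (d (t + -(n : ℝ)) + m) = _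
        rw [nestedRank_succ_add]
        have ht : nestedRank (k + 1) t = nestedRank (k + 1) (t + -(n : ℝ)) := by
          rw [← nestedRank_succ_add k (-n) t]; push_cast; rfl
        rw [ht]
        generalize t + -(n : ℝ) = s
        by_cases hs : s ∈ Ioo (0 : ℝ) 1
        · rw [← sigmoid_logit hs, hd, nestedRank_succ_sigmoid, nestedRank_succ_sigmoid, hc]
        · rw [hd' s hs]
      · change d (Real.sigmoid a + n + -(n : ℝ)) + m = _
        rw [add_neg_cancel_right, hd, hab]

/-! ### Vertices, open edges and their parametrizations -/

/-- Limits along an edge are found by lifting an ultrafilter to the parameter line, where it either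
converges or escapes to one end. -/
theorem ultrafilter_real_cases (W : Ultrafilter ℝ) :
    (W : Filter ℝ) ≤ atBot ∨ (W : Filter ℝ) ≤ atTop ∨ ∃ t, (W : Filter ℝ) ≤ 𝓝 t := by
  by_cases h : (W : Filter ℝ) ≤ cocompact ℝ
  · rw [cocompact_eq_atBot_atTop, Ultrafilter.le_sup_iff] at h
    tauto
  · right; right
    obtain ⟨s, hs, hsW⟩ := Filter.not_le.1 h
    obtain ⟨K, hK, hKs⟩ := mem_cocompact.1 hs
    have : K ∈ W := by
      by_contra hc
      exact hsW (mem_of_superset (Ultrafilter.compl_mem_iff_notMem.2 hc) hKs)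
    obtain ⟨t, -, ht⟩ := hK.ultrafilter_le_nhds W (le_principal_iff.2 this)
    exact ⟨t, ht⟩

/-- `ψ` parametrizes the open edge `e` by `ℝ`, with end points `a` and `b` in `V`. -/
structure IsParam {X : Type u} [TopologicalSpace X] (V e : Set X) (ψ : ℝ → X) (a b : X) :
    Prop where
  continuous : Continuous ψ
  injective : Function.Injective ψ
  range_eq : range ψ = e
  tendsto_atBot : Tendsto ψ atBot (𝓝 a)
  tendsto_atTop : Tendsto ψ atTop (𝓝 b)
  left_mem : a ∈ V
  right_mem : b ∈ V

/-- A decomposition of `X` into finitely many vertices and finitely many disjoint open edges. -/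
structure IsDecomp {X : Type u} [TopologicalSpace X] (V : Set X) (E : Set (Set X)) : Prop where
  finite_vertices : V.Finite
  finite_edges : E.Finite
  pairwiseDisjoint : E.PairwiseDisjoint id
  sUnion_eq : ⋃₀ E = Vᶜ
  exists_param : ∀ e ∈ E, ∃ ψ a b, IsParam V e ψ a b

variable {X : Type u} [TopologicalSpace X] {V : Set X} {E : Set (Set X)}

namespace IsParam

variable {e : Set X} {ψ : ℝ → X} {a b : X}

theorem mem (h : IsParam V e ψ a b) (t : ℝ) : ψ t ∈ e := h.range_eq ▸ mem_range_self t

theorem neg (h : IsParam V e ψ a b) : IsParam V e (fun t => ψ (-t)) b a where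
  continuous := h.continuous.comp continuous_neg
  injective := h.injective.comp neg_injective
  range_eq := by rw [← h.range_eq]; exact neg_surjective.range_comp ψ
  tendsto_atBot := h.tendsto_atTop.comp tendsto_neg_atBot_atTop
  tendsto_atTop := h.tendsto_atBot.comp tendsto_neg_atTop_atBot
  left_mem := h.right_mem
  right_mem := h.left_mem

theorem isPreconnected (h : IsParam V e ψ a b) : IsPreconnected e :=
  h.range_eq ▸ isPreconnected_range h.continuous

/-- A limit of parameters gives a limit on the edge. The end points arise only from parameters
escaping to infinity, hence only if `S` is unbounded on that side. -/
theorem mem_closure_image [T2Space X] (h : IsParam V e ψ a b) {S : Set ℝ} {x : X}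
    (hx : x ∈ closure (ψ '' S)) :
    (∃ t ∈ closure S, x = ψ t) ∨ (x = a ∧ ¬ BddBelow S) ∨ (x = b ∧ ¬ BddAbove S) := by
  obtain ⟨F, hF, hFx⟩ := mem_closure_iff_ultrafilter.1 hx
  let W := Ultrafilter.ofComapInfPrincipal hF
  have hSW : S ∈ W := Ultrafilter.ofComapInfPrincipal_mem hF
  have hW : W.map ψ = F := Ultrafilter.ofComapInfPrincipal_eq_of_map hF
  have hWx : Tendsto ψ W (𝓝 x) := by
    rw [← hW] at hFx; exact hFx
  rcases ultrafilter_real_cases W with h1 | h1 | ⟨t, h1⟩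
  · refine Or.inr (Or.inl ⟨tendsto_nhds_unique hWx (h.tendsto_atBot.mono_left h1), ?_⟩)
    rintro ⟨m, hm⟩
    obtain ⟨s, hs, hs'⟩ := W.nonempty_of_mem (W.inter_sets hSW (h1 (Iio_mem_atBot m)))
    exact absurd (hm hs) (not_le.2 hs')
  · refine Or.inr (Or.inr ⟨tendsto_nhds_unique hWx (h.tendsto_atTop.mono_left h1), ?_⟩)
    rintro ⟨m, hm⟩
    obtain ⟨s, hs, hs'⟩ := W.nonempty_of_mem (W.inter_sets hSW (h1 (Ioi_mem_atTop m)))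
    exact absurd (hm hs) (not_le.2 hs')
  · refine Or.inl ⟨t, mem_closure_iff_ultrafilter.2 ⟨W, hSW, h1⟩, ?_⟩
    exact tendsto_nhds_unique hWx ((h.continuous.tendsto t).mono_left h1)

theorem isClosed_union_image [T2Space X] (h : IsParam V e ψ a b) (hV : V.Finite) {S : Set ℝ}
    (hS : IsClosed S) : IsClosed (V ∪ ψ '' S) := by
  refine isClosed_of_closure_subset ?_
  rw [closure_union, hV.isClosed.closure_eq]
  refine union_subset subset_union_left fun x hx => ?_
  rcases h.mem_closure_image hx with ⟨t, ht, rfl⟩ | ⟨rfl, -⟩ | ⟨rfl, -⟩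
  · exact Or.inr ⟨t, hS.closure_eq ▸ ht, rfl⟩
  · exact Or.inl h.left_mem
  · exact Or.inl h.right_mem

end IsParam

namespace IsDecomp

theorem notMem_vertices (D : IsDecomp V E) {e : Set X} (he : e ∈ E) {x : X} (hx : x ∈ e) :
    x ∉ V := by
  have : x ∈ ⋃₀ E := ⟨e, he, hx⟩
  rwa [D.sUnion_eq] at this

theorem eq_of_mem (D : IsDecomp V E) {e e' : Set X} (he : e ∈ E) (he' : e' ∈ E) {x : X}
    (hx : x ∈ e) (hx' : x ∈ e') : e = e' :=
  D.pairwiseDisjoint.elim he he' (Set.not_disjoint_iff.2 ⟨x, hx, hx'⟩)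

theorem mem_or (D : IsDecomp V E) (x : X) : x ∈ V ∨ ∃ e ∈ E, x ∈ e := by
  by_cases hx : x ∈ V
  · exact Or.inl hx
  · have : x ∈ ⋃₀ E := D.sUnion_eq ▸ hx
    exact Or.inr this

theorem cases (D : IsDecomp V E) {ψ : Set X → ℝ → X} {a b : Set X → X}
    (hψ : ∀ e ∈ E, IsParam V e (ψ e) (a e) (b e)) (x : X) :
    x ∈ V ∨ ∃ e ∈ E, ∃ t, x = ψ e t := by
  refine (D.mem_or x).imp_right ?_
  rintro ⟨e, he, hx⟩
  rw [← (hψ e he).range_eq] at hx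
  obtain ⟨t, rfl⟩ := hx
  exact ⟨e, he, t, rfl⟩

variable [T2Space X]

theorem isClosed_vertices (D : IsDecomp V E) : IsClosed V := D.finite_vertices.isClosed

/-- The complement is a finite union of closed sets: the vertices with the rest of this edge, and
every other edge with the vertices. Finiteness of the decomposition thus makes the parametrizations
open embeddings. -/
theorem isOpen_image (D : IsDecomp V E) {e : Set X} (he : e ∈ E) {ψ : ℝ → X} {a b : X}
    (hψ : IsParam V e ψ a b) {U : Set ℝ} (hU : IsOpen U) : IsOpen (ψ '' U) := by
  have h1 : (ψ '' U)ᶜ = (V ∪ ψ '' Uᶜ) ∪ ⋃ e' ∈ E \ {e}, (V ∪ e') := by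
    ext x
    simp only [mem_compl_iff, mem_union, mem_iUnion, exists_prop]
    constructor
    · intro hx
      rcases D.mem_or x with h | ⟨e', he', hx'⟩
      · exact Or.inl (Or.inl h)
      · by_cases hee : e' = e
        · subst hee
          rw [← hψ.range_eq] at hx'
          obtain ⟨t, rfl⟩ := hx'
          exact Or.inl (Or.inr ⟨t, fun ht => hx ⟨t, ht, rfl⟩, rfl⟩)
        · exact Or.inr ⟨e', ⟨he', hee⟩, Or.inr hx'⟩
    · rintro ((h | ⟨t, ht, rfl⟩) | ⟨e', ⟨he', hee⟩, h | h⟩) ⟨s, hs, hsx⟩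
      · exact D.notMem_vertices he (hψ.mem s) (hsx ▸ h)
      · exact ht (hψ.injective hsx ▸ hs)
      · exact D.notMem_vertices he (hψ.mem s) (hsx ▸ h)
      · exact hee (D.eq_of_mem he' he h (hsx ▸ hψ.mem s))
  rw [← isClosed_compl_iff, h1]
  refine (hψ.isClosed_union_image D.finite_vertices hU.isClosed_compl).union ?_
  refine (D.finite_edges.subset sdiff_subset).isClosed_biUnion fun e' he' => ?_
  obtain ⟨ψ', a', b', h'⟩ := D.exists_param e' he'.1
  have := h'.isClosed_union_image D.finite_vertices isClosed_univ
  rwa [image_univ, h'.range_eq] at this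

theorem isOpenEmbedding (D : IsDecomp V E) {e : Set X} (he : e ∈ E) {ψ : ℝ → X} {a b : X}
    (hψ : IsParam V e ψ a b) : IsOpenEmbedding ψ :=
  IsOpenEmbedding.of_continuous_injective_isOpenMap hψ.continuous hψ.injective
    fun _ hU => D.isOpen_image he hψ hU

theorem isOpen_edge (D : IsDecomp V E) {e : Set X} (he : e ∈ E) : IsOpen e := by
  obtain ⟨ψ, a, b, hψ⟩ := D.exists_param e he
  exact hψ.range_eq ▸ (D.isOpenEmbedding he hψ).isOpen_range

/-- Two parametrizations of the same edge differ by an order automorphism of `ℝ`, up to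
orientation. -/
theorem exists_orderIso_param (D : IsDecomp V E) {e : Set X} (he : e ∈ E) {ψ ψ' : ℝ → X}
    {a b a' b' : X} (h : IsParam V e ψ a b) (h' : IsParam V e ψ' a' b') :
    ∃ c : ℝ ≃o ℝ, (∀ t, ψ' (c t) = ψ t) ∨ ∀ t, ψ' (c t) = ψ (-t) := by
  have hr : ∀ t, ∃ s, ψ' s = ψ t := fun t => by
    have := h.mem t
    rwa [← h'.range_eq] at this
  choose β hβ using hr
  have hcont : Continuous β := by
    rw [(D.isOpenEmbedding he h').continuous_iff]
    convert h.continuous using 1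
    exact funext hβ
  have hinj : Function.Injective β := fun s t hst => h.injective (by rw [← hβ, hst, hβ])
  have hsurj : Function.Surjective β := fun s => by
    have := h'.mem s
    rw [← h.range_eq] at this
    obtain ⟨t, ht⟩ := this
    exact ⟨t, h'.injective (by rw [hβ, ht])⟩
  -- A continuous bijective change of parameter is monotone in one direction; a decreasing one
  -- becomes increasing after reversing `ψ`.
  rcases hcont.strictMono_of_inj hinj with hm | hm
  · exact ⟨hm.orderIsoOfSurjective β hsurj, Or.inl hβ⟩
  · have hm' : StrictMono fun t => β (-t) := fun s t hst => hm (neg_lt_neg hst)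
    exact ⟨hm'.orderIsoOfSurjective _ (hsurj.comp neg_surjective), Or.inr fun t => hβ (-t)⟩

/-- An order automorphism of `ℝ` fixes both ends at infinity, so the edge maps fit together with the
identity on the vertices. As there are finitely many edges, every ultrafilter contains `V` or a
single edge, and continuity can be checked there. -/
theorem exists_continuous_extension (D : IsDecomp V E) {ψ : Set X → ℝ → X} {a b : Set X → X}
    (hψ : ∀ e ∈ E, IsParam V e (ψ e) (a e) (b e)) (c : Set X → (ℝ ≃o ℝ)) :
    ∃ C : X → X, Continuous C ∧ (∀ v ∈ V, C v = v) ∧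
      ∀ e ∈ E, ∀ t, C (ψ e t) = ψ e (c e t) := by
  classical
  have hex : ∀ x, ∃ y, (x ∈ V → y = x) ∧ ∀ e ∈ E, ∀ t, x = ψ e t → y = ψ e (c e t) := by
    intro x
    rcases D.cases hψ x with hx | ⟨e, he, t, rfl⟩
    · refine ⟨x, fun _ => rfl, fun e he t hxt => ?_⟩
      exact absurd hx (D.notMem_vertices he (hxt ▸ (hψ e he).mem t))
    · refine ⟨ψ e (c e t), fun hx => absurd hx (D.notMem_vertices he ((hψ e he).mem t)), ?_⟩
      intro e' he' s hs
      obtain rfl := D.eq_of_mem he he' ((hψ e he).mem t) (hs ▸ (hψ e' he').mem s)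
      rw [(hψ e he).injective hs]
  choose C hCV hCE using hex
  refine ⟨C, ?_, fun v hv => hCV v hv, fun e he t => hCE _ e he t rfl⟩
  refine continuous_iff_ultrafilter.2 fun x F hFx => ?_
  have hcover : V ∪ ⋃ e ∈ E, e = univ := by
    refine eq_univ_of_forall fun y => ?_
    rcases D.mem_or y with h | ⟨e, he, hy⟩
    · exact Or.inl h
    · exact Or.inr (mem_biUnion he hy)
  have hFc : V ∪ ⋃ e ∈ E, e ∈ F := hcover ▸ univ_mem
  rcases Ultrafilter.union_mem_iff.1 hFc with hF | hF
  · have hxV : x ∈ V := by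
      rw [← D.isClosed_vertices.closure_eq]
      exact mem_closure_iff_ultrafilter.2 ⟨F, hF, hFx⟩
    rw [hCV x hxV]
    refine Tendsto.congr' ?_ (tendsto_id'.2 hFx)
    filter_upwards [hF] with y hy using (hCV y hy).symm
  · obtain ⟨e, he, hF⟩ := (Ultrafilter.finite_biUnion_mem_iff D.finite_edges).1 hF
    have h := hψ e he
    rw [← h.range_eq, ← image_univ] at hF
    let W := Ultrafilter.ofComapInfPrincipal hF
    have hW : W.map (ψ e) = F := Ultrafilter.ofComapInfPrincipal_eq_of_map hF
    have hWx : Tendsto (ψ e) W (𝓝 x) := by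
      rw [← hW] at hFx; exact hFx
    rw [← hW, Ultrafilter.coe_map, tendsto_map'_iff]
    have hcomp : C ∘ ψ e = ψ e ∘ c e := funext fun t => hCE _ e he t rfl
    rw [hcomp]
    rcases ultrafilter_real_cases W with h1 | h1 | ⟨t, h1⟩
    · obtain rfl : x = a e := tendsto_nhds_unique hWx (h.tendsto_atBot.mono_left h1)
      rw [hCV _ h.left_mem]
      exact h.tendsto_atBot.comp ((c e).tendsto_atBot.mono_left h1)
    · obtain rfl : x = b e := tendsto_nhds_unique hWx (h.tendsto_atTop.mono_left h1)
      rw [hCV _ h.right_mem]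
      exact h.tendsto_atTop.comp ((c e).tendsto_atTop.mono_left h1)
    · obtain rfl : x = ψ e t := tendsto_nhds_unique hWx ((h.continuous.tendsto t).mono_left h1)
      rw [hCE _ e he t rfl]
      exact ((h.continuous.comp (c e).continuous).tendsto t).mono_left h1

/-- Order automorphisms of the edges extend to a homeomorphism fixing the vertices. -/
theorem exists_homeomorph_extension (D : IsDecomp V E) {ψ : Set X → ℝ → X} {a b : Set X → X}
    (hψ : ∀ e ∈ E, IsParam V e (ψ e) (a e) (b e)) (c : Set X → (ℝ ≃o ℝ)) :
    ∃ C : X ≃ₜ X, (∀ v ∈ V, C v = v) ∧ ∀ e ∈ E, ∀ t, C (ψ e t) = ψ e (c e t) := by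
  obtain ⟨C, hC, hCV, hCE⟩ := D.exists_continuous_extension hψ c
  obtain ⟨C', hC', hCV', hCE'⟩ := D.exists_continuous_extension hψ fun e => (c e).symm
  refine ⟨⟨⟨C, C', fun x => ?_, fun x => ?_⟩, hC, hC'⟩, hCV, hCE⟩
  · rcases D.cases hψ x with hx | ⟨e, he, t, rfl⟩
    · rw [hCV x hx, hCV' x hx]
    · rw [hCE e he, hCE' e he, OrderIso.symm_apply_apply]
  · rcases D.cases hψ x with hx | ⟨e, he, t, rfl⟩
    · rw [hCV' x hx, hCV x hx]
    · rw [hCE' e he, hCE e he, OrderIso.apply_symm_apply]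

end IsDecomp

/-! ### Half edges at a vertex with a line neighbourhood -/

/-- `x` has an open neighbourhood homeomorphic to the real line. -/
def IsLinePoint (x : X) : Prop := ∃ χ : ℝ → X, IsOpenEmbedding χ ∧ χ 0 = x

theorem IsLinePoint.map {x : X} (h : IsLinePoint x) (f : X ≃ₜ X) : IsLinePoint (f x) := by
  obtain ⟨χ, hχ, rfl⟩ := h
  exact ⟨f ∘ χ, f.isOpenEmbedding.comp hχ, rfl⟩

/-- The parametrization `ψ`, reversed when `s` is false. -/
def orient (ψ : Set X → ℝ → X) (p : Set X × Bool) (t : ℝ) : X :=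
  if p.2 then ψ p.1 t else ψ p.1 (-t)

/-- A pair of an edge and a Boolean names a half edge, and `z` is the vertex to which it converges.
Changing the Boolean gives the other end, so a loop counts twice at its vertex. -/
theorem exists_isParam_orient {ψ : Set X → ℝ → X} {a b : Set X → X}
    (hψ : ∀ e ∈ E, IsParam V e (ψ e) (a e) (b e)) :
    ∃ z : Set X × Bool → X, ∀ p : Set X × Bool, p.1 ∈ E →
      IsParam V p.1 (orient ψ p) (z (p.1, !p.2)) (z p) := by
  refine ⟨fun p => if p.2 then b p.1 else a p.1, ?_⟩
  rintro ⟨e, _ | _⟩ he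
  · exact (hψ e he).neg
  · exact hψ e he

theorem orient_eq_orient_not {Y : Type u} (ψ : Set Y → ℝ → Y) (p : Set Y × Bool) (t : ℝ) :
    orient ψ (p.1, !p.2) t = orient ψ p (-t) := by
  rcases p with ⟨e, _ | _⟩ <;> simp [orient]

namespace IsDecomp

variable {ψ : Set X → ℝ → X} {z : Set X × Bool → X}

/-- The parameter `0` cuts each edge into two disjoint open halves, and different edges are
disjoint. -/
theorem eq_of_orient_eq (D : IsDecomp V E)
    (hψ : ∀ p : Set X × Bool, p.1 ∈ E → IsParam V p.1 (orient ψ p) (z (p.1, !p.2)) (z p))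
    {p q : Set X × Bool} (hp : p.1 ∈ E) (hq : q.1 ∈ E)
    {x : X} (hxp : x ∈ orient ψ p '' Ioi 0) (hxq : x ∈ orient ψ q '' Ioi 0) : p = q := by
  obtain ⟨s, hs, rfl⟩ := hxp
  obtain ⟨t, ht, hst⟩ := hxq
  have h1 : q.1 = p.1 := D.eq_of_mem hq hp ((hψ q hq).mem t) (hst ▸ (hψ p hp).mem s)
  by_contra hne
  have h2 : q = (p.1, !p.2) := by
    refine Prod.ext h1 ?_
    by_contra h
    exact hne (Prod.ext h1.symm (by
      cases hp2 : p.2 <;> cases hq2 : q.2 <;> simp_all))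
  rw [h2, orient_eq_orient_not] at hst
  have := (hψ p hp).injective hst
  simp only [mem_Ioi] at hs ht
  linarith

theorem mem_closure_side {χ : ℝ → X} (hχ : Continuous χ) {δ : ℝ} (hδ : 0 < δ) :
    χ 0 ∈ closure (χ '' Ioo 0 δ) := by
  refine image_closure_subset_closure_image hχ ⟨0, ?_, rfl⟩
  rw [closure_Ioo hδ.ne]
  exact ⟨le_rfl, hδ.le⟩

theorem end_mem_closure {e : Set X} {ψ : ℝ → X} {a b : X}
    (hψ : IsParam V e ψ a b) : b ∈ closure (ψ '' Ioi 0) :=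
  mem_closure_of_tendsto hψ.tendsto_atTop
    (mem_of_superset (Ioi_mem_atTop 0) fun t ht => ⟨t, ht, rfl⟩)

variable [T2Space X]

/-- One side of a line neighbourhood of a vertex lies in a single half edge. -/
theorem exists_half_of_side (D : IsDecomp V E)
    (hψ : ∀ p : Set X × Bool, p.1 ∈ E → IsParam V p.1 (orient ψ p) (z (p.1, !p.2)) (z p))
    {χ : ℝ → X} (hχ : IsOpenEmbedding χ) :
    ∃ p : Set X × Bool, p.1 ∈ E ∧ ∃ δ > 0, χ '' Ioo 0 δ ⊆ orient ψ p '' Ioi 0 := by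
  -- For small `δ` the side avoids all vertices and all cut points `ψ e 0`. It is then covered by
  -- the disjoint open half edges, and being connected it lies in one of them.
  have hWf : ((V ∪ (fun e => ψ e 0) '' E) \ {χ 0}).Finite :=
    (D.finite_vertices.union (D.finite_edges.image _)).subset sdiff_subset
  have hn : χ ⁻¹' ((V ∪ (fun e => ψ e 0) '' E) \ {χ 0})ᶜ ∈ 𝓝 (0 : ℝ) :=
    (hWf.isClosed.isOpen_compl.preimage hχ.continuous).mem_nhds (fun h => h.2 rfl)
  obtain ⟨δ, hδ, hball⟩ := Metric.mem_nhds_iff.1 hn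
  have hcov : ∀ t ∈ Ioo 0 δ, ∃ p : Set X × Bool, p.1 ∈ E ∧ χ t ∈ orient ψ p '' Ioi 0 := by
    intro t ht
    have h1 : χ t ∉ (V ∪ (fun e => ψ e 0) '' E) := by
      intro h
      refine hball (show t ∈ Metric.ball 0 δ by
        rw [Real.ball_eq_Ioo]; exact ⟨by linarith [ht.1], by linarith [ht.2]⟩) ⟨h, fun h0 => ?_⟩
      exact ht.1.ne' (hχ.injective h0)
    rcases D.mem_or (χ t) with h | ⟨e, he, h⟩
    · exact absurd (Or.inl h) h1
    · have h' := h
      replace h' : χ t ∈ range (orient ψ (e, true)) := (hψ (e, true) he).range_eq.symm ▸ h'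
      obtain ⟨s, hs⟩ := h'
      rcases lt_trichotomy s 0 with hs0 | rfl | hs0
      · refine ⟨(e, false), he, -s, by simpa using hs0, ?_⟩
        simpa [orient] using hs
      · exact absurd (Or.inr ⟨e, he, by simpa [orient] using hs⟩) h1
      · exact ⟨(e, true), he, s, hs0, hs⟩
  obtain ⟨p, hp, hpx⟩ := hcov (δ / 2) ⟨by linarith, by linarith⟩
  refine ⟨p, hp, δ, hδ, ?_⟩
  have hopen : ∀ q : Set X × Bool, q.1 ∈ E → IsOpen (orient ψ q '' Ioi 0) := fun q hq =>
    D.isOpen_image hq (hψ q hq) isOpen_Ioi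
  refine IsPreconnected.subset_left_of_subset_union (hopen p hp)
    (v := ⋃ q ∈ {q : Set X × Bool | q.1 ∈ E ∧ q ≠ p}, orient ψ q '' Ioi 0)
    (isOpen_biUnion fun q hq => hopen q hq.1) ?_ ?_
    ⟨χ (δ / 2), ⟨δ / 2, ⟨by linarith, by linarith⟩, rfl⟩, hpx⟩
    (isPreconnected_Ioo.image χ hχ.continuous.continuousOn)
  · refine Set.disjoint_left.2 fun x hx hx' => ?_
    obtain ⟨q, hq, hxq⟩ := mem_iUnion₂.1 hx'
    exact hq.2 (D.eq_of_orient_eq hψ hq.1 hp hxq hx)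
  · rintro _ ⟨t, ht, rfl⟩
    obtain ⟨q, hq, hqx⟩ := hcov t ht
    by_cases hqp : q = p
    · exact Or.inl (hqp ▸ hqx)
    · exact Or.inr (mem_biUnion (show q ∈ {q : Set X × Bool | q.1 ∈ E ∧ q ≠ p} from ⟨hq, hqp⟩) hqx)

theorem eq_end_of_mem_closure (D : IsDecomp V E) {e : Set X} (he : e ∈ E) {ψ : ℝ → X} {a b : X}
    (hψ : IsParam V e ψ a b) {v : X} (hv : v ∈ V) (h : v ∈ closure (ψ '' Ioi 0)) : v = b := by
  rcases hψ.mem_closure_image h with ⟨t, -, rfl⟩ | ⟨-, h⟩ | ⟨h, -⟩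
  · exact absurd hv (D.notMem_vertices he (hψ.mem t))
  · exact absurd bddBelow_Ioi h
  · exact h

/-- A half edge converging to a vertex meets any side of a line neighbourhood lying in it. -/
theorem exists_ge_mem_side (D : IsDecomp V E) {e : Set X} (he : e ∈ E) {ψ : ℝ → X} {a b : X}
    (hψ : IsParam V e ψ a b) {χ : ℝ → X} (hχ : Continuous χ) (hv : χ 0 ∈ V) {δ : ℝ}
    (hδ : 0 < δ) (hsub : χ '' Ioo 0 δ ⊆ ψ '' Ioi 0) (T : ℝ) :
    ∃ t ≥ T, ψ t ∈ χ '' Ioo 0 δ := by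
  by_contra! hcon
  -- Otherwise the side uses only bounded parameters, and no vertex is in the closure of such a
  -- piece of an edge, although `χ 0` is.
  have h1 : χ '' Ioo 0 δ ⊆ ψ '' Ioo 0 T := by
    intro x hx
    obtain ⟨t, ht, rfl⟩ := hsub hx
    exact ⟨t, ⟨ht, by by_contra h; exact hcon t (not_lt.1 h) hx⟩, rfl⟩
  rcases hψ.mem_closure_image (closure_mono h1 (mem_closure_side hχ hδ)) with
    ⟨t, -, ht⟩ | ⟨-, h⟩ | ⟨-, h⟩
  · exact D.notMem_vertices he (ht ▸ hψ.mem t) hv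
  · exact h bddBelow_Ioo
  · exact h bddAbove_Ioo

/-- Both sides of a line neighbourhood of a vertex cannot lie in the same half edge. -/
theorem sides_ne (D : IsDecomp V E) {e : Set X} (he : e ∈ E) {ψ : ℝ → X} {a b : X}
    (hψ : IsParam V e ψ a b) {χ : ℝ → X} (hχ : IsOpenEmbedding χ) (hv : χ 0 ∈ V) {δ : ℝ}
    (hδ : 0 < δ) (h1 : χ '' Ioo 0 δ ⊆ ψ '' Ioi 0)
    (h2 : (fun t => χ (-t)) '' Ioo 0 δ ⊆ ψ '' Ioi 0) : False := by
  have hb : χ 0 = b :=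
    D.eq_end_of_mem_closure he hψ hv (closure_mono h1 (mem_closure_side hχ.continuous hδ))
  have hnhds : χ '' Ioo (-δ) δ ∈ 𝓝 b :=
    (hχ.isOpenMap _ isOpen_Ioo).mem_nhds ⟨0, ⟨by linarith, hδ⟩, hb⟩
  obtain ⟨T, hT⟩ := eventually_atTop.1 (hψ.tendsto_atTop.eventually hnhds)
  have hneg : Continuous fun t => χ (-t) := hχ.continuous.comp continuous_neg
  obtain ⟨t, ht, s, hs, hst⟩ := D.exists_ge_mem_side he hψ hχ.continuous hv hδ h1 T
  obtain ⟨t', ht', s', hs', hst'⟩ := D.exists_ge_mem_side he hψ hneg (by simpa using hv) hδ h2 T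
  have hpre : IsPreconnected (ψ '' Ici T) := isPreconnected_Ici.image ψ hψ.continuous.continuousOn
  -- The tail of the half edge is connected and avoids the vertex `χ 0`, so it stays on one side,
  -- although it meets both.
  have hsub : ψ '' Ici T ⊆ χ '' Ioo 0 δ := by
    refine IsPreconnected.subset_left_of_subset_union (hχ.isOpenMap _ isOpen_Ioo)
      (hχ.isOpenMap _ (isOpen_Ioo (a := -δ) (b := 0))) ?_ ?_ ⟨ψ t, ⟨t, ht, rfl⟩, s, hs, hst⟩ hpre
    · refine (Set.disjoint_image_iff hχ.injective).2 (Set.disjoint_left.2 fun x hx hx' => ?_)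
      exact absurd hx.1 (not_lt.2 hx'.2.le)
    · rintro _ ⟨r, hr, rfl⟩
      obtain ⟨x, hx, hxr⟩ := hT r hr
      rcases lt_trichotomy x 0 with h | rfl | h
      · exact Or.inr ⟨x, ⟨hx.1, h⟩, hxr⟩
      · exact absurd hv (D.notMem_vertices he (hxr ▸ hψ.mem r))
      · exact Or.inl ⟨x, ⟨h, hx.2⟩, hxr⟩
  obtain ⟨x, hx, hxt⟩ := hsub ⟨t', ht', rfl⟩
  have := hχ.injective (hxt.trans hst'.symm)
  linarith [hx.1, hs'.1]

/-- A vertex with a line neighbourhood is the end of exactly two half edges. -/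
theorem exists_two_halves (D : IsDecomp V E)
    (hψ : ∀ p : Set X × Bool, p.1 ∈ E → IsParam V p.1 (orient ψ p) (z (p.1, !p.2)) (z p))
    {v : X} (hv : v ∈ V) (hl : IsLinePoint v) :
    ∃ p q : Set X × Bool, p.1 ∈ E ∧ q.1 ∈ E ∧ p ≠ q ∧
      (∀ r : Set X × Bool, r.1 ∈ E → (z r = v ↔ r = p ∨ r = q)) ∧
      insert v (p.1 ∪ q.1) ∈ 𝓝 v := by
  obtain ⟨χ, hχ, rfl⟩ := hl
  have hχ' : IsOpenEmbedding fun t => χ (-t) := hχ.comp (Homeomorph.neg ℝ).isOpenEmbedding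
  obtain ⟨p, hp, δ₁, hδ₁, h1⟩ := D.exists_half_of_side hψ hχ
  obtain ⟨q, hq, δ₂, hδ₂, h2⟩ := D.exists_half_of_side hψ hχ'
  obtain ⟨δ, hδ, hδ1, hδ2⟩ : ∃ δ > 0, δ ≤ δ₁ ∧ δ ≤ δ₂ :=
    ⟨min δ₁ δ₂, lt_min hδ₁ hδ₂, min_le_left _ _, min_le_right _ _⟩
  replace h1 := (image_mono (Ioo_subset_Ioo_right hδ1)).trans h1
  replace h2 := (image_mono (Ioo_subset_Ioo_right hδ2)).trans h2
  have hnhds : χ '' Ioo (-δ) δ ∈ 𝓝 (χ 0) :=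
    (hχ.isOpenMap _ isOpen_Ioo).mem_nhds ⟨0, ⟨by linarith, hδ⟩, rfl⟩
  have hcase : ∀ x ∈ χ '' Ioo (-δ) δ, x = χ 0 ∨ x ∈ orient ψ p '' Ioi 0 ∨
      x ∈ orient ψ q '' Ioi 0 := by
    rintro _ ⟨x, hx, rfl⟩
    rcases lt_trichotomy x 0 with h | rfl | h
    · exact Or.inr (Or.inr (h2 ⟨-x, ⟨by linarith, by linarith [hx.1]⟩, by simp⟩))
    · exact Or.inl rfl
    · exact Or.inr (Or.inl (h1 ⟨x, ⟨h, hx.2⟩, rfl⟩))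
  refine ⟨p, q, hp, hq, ?_, fun r hr => ⟨fun hz => ?_, ?_⟩, mem_of_superset hnhds fun x hx => ?_⟩
  · rintro rfl
    exact D.sides_ne hp (hψ p hp) hχ hv hδ h1 h2
  · obtain ⟨y, hy, hyr⟩ := mem_closure_iff_nhds.1 (end_mem_closure (hψ r hr)) _ (hz ▸ hnhds)
    rcases hcase y hy with rfl | h | h
    · obtain ⟨t, -, ht⟩ := hyr
      exact absurd hv (D.notMem_vertices hr (ht ▸ (hψ r hr).mem t))
    · exact Or.inl (D.eq_of_orient_eq hψ hr hp hyr h)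
    · exact Or.inr (D.eq_of_orient_eq hψ hr hq hyr h)
  · rintro (rfl | rfl)
    · exact (D.eq_end_of_mem_closure hr (hψ r hr) hv
        (closure_mono h1 (mem_closure_side hχ.continuous hδ))).symm
    · refine (D.eq_end_of_mem_closure hr (hψ r hr) hv (closure_mono h2 ?_)).symm
      simpa using mem_closure_side hχ'.continuous hδ
  · rcases hcase x hx with rfl | ⟨t, -, rfl⟩ | ⟨t, -, rfl⟩
    · exact mem_insert _ _
    · exact Or.inr (Or.inl ((hψ p hp).mem t))
    · exact Or.inr (Or.inr ((hψ q hq).mem t))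

end IsDecomp

/-! ### Merging edges and the normal form -/

/-- Two edges with a common end point `v` form a longer edge. -/
theorem IsParam.concat {e₁ e₂ : Set X} {ψ₁ ψ₂ : ℝ → X} {a b v : X} (h₁ : IsParam V e₁ ψ₁ a v)
    (h₂ : IsParam V e₂ ψ₂ v b) (hd : Disjoint e₁ e₂) (hv₁ : v ∉ e₁) (hv₂ : v ∉ e₂)
    (ha : a ≠ v) (hb : b ≠ v) :
    ∃ ω, IsParam (V \ {v}) (insert v (e₁ ∪ e₂)) ω a b := by
  -- The negative and the positive half line are stretched to `ℝ` by logarithms, so that the end of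
  -- `ψ₁` and the beginning of `ψ₂` are joined at `0`.
  let ω : ℝ → X := fun t =>
    if t < 0 then ψ₁ (-Real.log (-t)) else if t = 0 then v else ψ₂ (Real.log t)
  have hneg : ∀ t < 0, ω t = ψ₁ (-Real.log (-t)) := fun t ht => if_pos ht
  have hpos : ∀ t > 0, ω t = ψ₂ (Real.log t) := fun t ht => by
    simp only [ω, if_neg (not_lt.2 ht.le), if_neg ht.ne']
  have hzero : ω 0 = v := by simp [ω]
  have hcneg : ∀ t < 0, ContinuousAt ω t := fun t ht => by
    have : ContinuousAt (fun t => ψ₁ (-Real.log (-t))) t :=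
      h₁.continuous.continuousAt.comp (((Real.continuousAt_log (by linarith : -t ≠ 0)).comp
        continuous_neg.continuousAt).neg)
    refine this.congr ?_
    filter_upwards [Iio_mem_nhds ht] with s hs using (hneg s hs).symm
  have hcpos : ∀ t > 0, ContinuousAt ω t := fun t ht => by
    have : ContinuousAt (fun t => ψ₂ (Real.log t)) t :=
      h₂.continuous.continuousAt.comp (Real.continuousAt_log ht.ne')
    refine this.congr ?_
    filter_upwards [Ioi_mem_nhds ht] with s hs using (hpos s hs).symm
  have hc0 : ContinuousAt ω 0 := by
    refine continuousAt_iff_continuous_left'_right'.2 ⟨?_, ?_⟩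
    · have h1 : Tendsto (fun t : ℝ => -t) (𝓝[<] 0) (𝓝[>] 0) := by
        simpa using tendsto_neg_nhdsLT (a := (0 : ℝ))
      have h2 : Tendsto (fun t => ψ₁ (-Real.log (-t))) (𝓝[<] 0) (𝓝 v) :=
        h₁.tendsto_atTop.comp (tendsto_neg_atBot_atTop.comp (Real.tendsto_log_nhdsGT_zero.comp h1))
      rw [ContinuousWithinAt, hzero]
      refine h2.congr' ?_
      filter_upwards [self_mem_nhdsWithin] with s hs using (hneg s hs).symm
    · have h2 : Tendsto (fun t => ψ₂ (Real.log t)) (𝓝[>] 0) (𝓝 v) :=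
        h₂.tendsto_atBot.comp Real.tendsto_log_nhdsGT_zero
      rw [ContinuousWithinAt, hzero]
      refine h2.congr' ?_
      filter_upwards [self_mem_nhdsWithin] with s hs using (hpos s hs).symm
  have hmneg : ∀ t < 0, ω t ∈ e₁ := fun t ht => hneg t ht ▸ h₁.mem _
  have hmpos : ∀ t > 0, ω t ∈ e₂ := fun t ht => hpos t ht ▸ h₂.mem _
  refine ⟨ω, ?_, ?_, ?_, ?_, ?_, ⟨h₁.left_mem, ha⟩, ⟨h₂.right_mem, hb⟩⟩
  · refine continuous_iff_continuousAt.2 fun t => ?_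
    rcases lt_trichotomy t 0 with h | rfl | h
    exacts [hcneg t h, hc0, hcpos t h]
  · intro s t hst
    rcases lt_trichotomy s 0 with hs | rfl | hs <;> rcases lt_trichotomy t 0 with ht | rfl | ht
    · rw [hneg s hs, hneg t ht] at hst
      have := Real.log_injOn_pos (show -s ∈ Ioi 0 by simpa using hs)
        (show -t ∈ Ioi 0 by simpa using ht) (neg_injective (h₁.injective hst))
      exact neg_injective this
    · exact absurd (hzero ▸ hst ▸ hmneg s hs) hv₁
    · exact absurd (hst ▸ hmpos t ht) (Set.disjoint_left.1 hd (hmneg s hs))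
    · exact absurd (hzero ▸ hst ▸ hmneg t ht) hv₁
    · rfl
    · exact absurd (hzero ▸ hst ▸ hmpos t ht) hv₂
    · exact absurd (hst ▸ hmpos s hs) (Set.disjoint_left.1 hd (hmneg t ht))
    · exact absurd (hzero ▸ hst ▸ hmpos s hs) hv₂
    · rw [hpos s hs, hpos t ht] at hst
      exact Real.log_injOn_pos hs ht (h₂.injective hst)
  · refine Subset.antisymm ?_ ?_
    · rintro _ ⟨t, rfl⟩
      rcases lt_trichotomy t 0 with h | rfl | h
      exacts [Or.inr (Or.inl (hmneg t h)), Or.inl hzero, Or.inr (Or.inr (hmpos t h))]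
    · rintro x (rfl | hx | hx)
      · exact ⟨0, hzero⟩
      · rw [← h₁.range_eq] at hx
        obtain ⟨t, rfl⟩ := hx
        refine ⟨-Real.exp (-t), ?_⟩
        rw [hneg _ (by simpa using Real.exp_pos (-t))]
        simp
      · rw [← h₂.range_eq] at hx
        obtain ⟨t, rfl⟩ := hx
        refine ⟨Real.exp t, ?_⟩
        rw [hpos _ (Real.exp_pos t)]
        simp
  · have : Tendsto (fun t => ψ₁ (-Real.log (-t))) atBot (𝓝 a) :=
      h₁.tendsto_atBot.comp (tendsto_neg_atTop_atBot.comp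
        (Real.tendsto_log_atTop.comp tendsto_neg_atBot_atTop))
    refine this.congr' ?_
    filter_upwards [Iio_mem_atBot 0] with s hs using (hneg s hs).symm
  · refine (h₂.tendsto_atTop.comp Real.tendsto_log_atTop).congr' ?_
    filter_upwards [Ioi_mem_atTop 0] with s hs using (hpos s hs).symm

/-- Removing a vertex where exactly two distinct edges end. -/
theorem IsDecomp.merge (D : IsDecomp V E) {e₁ e₂ : Set X} (he₁ : e₁ ∈ E) (he₂ : e₂ ∈ E)
    (hne : e₁ ≠ e₂) {ψ₁ ψ₂ : ℝ → X} {a b v : X} (h₁ : IsParam V e₁ ψ₁ a v)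
    (h₂ : IsParam V e₂ ψ₂ v b) (ha : a ≠ v) (hb : b ≠ v)
    (hE : ∀ e ∈ E, e ≠ e₁ → e ≠ e₂ → ∃ ψ a b, IsParam V e ψ a b ∧ a ≠ v ∧ b ≠ v) :
    IsDecomp (V \ {v}) (insert (insert v (e₁ ∪ e₂)) (E \ {e₁, e₂})) := by
  have hv : v ∈ V := h₁.right_mem
  have hvE : ∀ e ∈ E, v ∉ e := fun e he h => D.notMem_vertices he h hv
  refine ⟨D.finite_vertices.subset sdiff_subset, (D.finite_edges.subset sdiff_subset).insert _,
    ?_, ?_, ?_⟩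
  · have key : ∀ e ∈ E \ {e₁, e₂}, Disjoint (insert v (e₁ ∪ e₂)) e := by
      rintro e ⟨he, hee⟩
      refine Set.disjoint_left.2 ?_
      rintro x (rfl | hx | hx) hxe
      · exact hvE e he hxe
      · exact hee (Or.inl (D.eq_of_mem he he₁ hxe hx))
      · exact hee (Or.inr (D.eq_of_mem he he₂ hxe hx))
    refine (D.pairwiseDisjoint.subset sdiff_subset).insert fun e he _ => key e he
  · rw [sUnion_insert]
    ext x
    simp only [mem_union, mem_compl_iff, Set.mem_sdiff, mem_singleton_iff, not_and, not_not]
    constructor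
    · rintro ((rfl | h | h) | ⟨e, he, h⟩) hx
      · rfl
      · exact absurd hx (D.notMem_vertices he₁ h)
      · exact absurd hx (D.notMem_vertices he₂ h)
      · exact absurd hx (D.notMem_vertices he.1 h)
    · intro hx
      rcases D.mem_or x with h | ⟨e, he, h⟩
      · exact Or.inl (Or.inl (hx h))
      · by_cases h1 : e = e₁
        · exact Or.inl (Or.inr (Or.inl (h1 ▸ h)))
        by_cases h2 : e = e₂
        · exact Or.inl (Or.inr (Or.inr (h2 ▸ h)))
        exact Or.inr ⟨e, ⟨he, by simp [h1, h2]⟩, h⟩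
  · rintro e (rfl | ⟨he, hee⟩)
    · obtain ⟨ω, hω⟩ := h₁.concat h₂ (D.pairwiseDisjoint he₁ he₂ hne) (hvE _ he₁) (hvE _ he₂) ha hb
      exact ⟨ω, a, b, hω⟩
    · obtain ⟨ψ, a, b, h, ha, hb⟩ := hE e he (fun h => hee (Or.inl h)) (fun h => hee (Or.inr h))
      exact ⟨ψ, a, b, h.1, h.2, h.3, h.4, h.5, ⟨h.6, ha⟩, ⟨h.7, hb⟩⟩

/-- A connected graph has a decomposition all of whose vertices are singular, unless it has a
decomposition with one vertex and one edge. -/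
theorem IsDecomp.exists_normal_form [T2Space X] [ConnectedSpace X] (D : IsDecomp V E) :
    ∃ V' E', IsDecomp (X := X) V' E' ∧ ((∀ v ∈ V', ¬ IsLinePoint v) ∨
      ∃ v e ψ, V' = {v} ∧ E' = {e} ∧ IsParam {v} e ψ v v) := by
  -- Every merge removes one vertex.
  induction hn : V.ncard using Nat.strong_induction_on generalizing V E with
  | _ n ih =>
  by_cases hall : ∀ v ∈ V, ¬ IsLinePoint v
  · exact ⟨V, E, D, Or.inl hall⟩
  push Not at hall
  obtain ⟨v, hv, hl⟩ := hall
  have hex : ∀ e, ∃ ψ a b, e ∈ E → IsParam V e ψ a b := by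
    intro e
    by_cases he : e ∈ E
    · obtain ⟨ψ, a, b, h⟩ := D.exists_param e he
      exact ⟨ψ, a, b, fun _ => h⟩
    · exact ⟨fun _ => v, v, v, fun h => absurd h he⟩
  choose ψ a b hψ using hex
  obtain ⟨z, hz⟩ := exists_isParam_orient hψ
  obtain ⟨p, q, hp, hq, hpq, hends, hnhds⟩ := D.exists_two_halves hz hv hl
  -- If both half edges at `v` belong to one edge, that loop together with `v` is open and closed,
  -- hence all of `X`.
  by_cases hedge : p.1 = q.1
  · have hq' : q = (p.1, !p.2) := by
      refine Prod.ext hedge.symm ?_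
      by_contra h
      exact hpq (Prod.ext hedge (by cases hp2 : p.2 <;> cases hq2 : q.2 <;> simp_all))
    have hpar : IsParam V p.1 (orient ψ p) v v := by
      have := hz p hp
      rwa [(hends p hp).2 (Or.inl rfl), ← hq', (hends q hq).2 (Or.inr rfl)] at this
    have hcl : IsClosed (insert v p.1) := by
      refine isClosed_of_closure_subset fun x hx => ?_
      rw [insert_eq, closure_union, closure_singleton] at hx
      rcases hx with hx | hx
      · exact Or.inl hx
      · rw [← hpar.range_eq, ← image_univ] at hx
        rcases hpar.mem_closure_image hx with ⟨t, -, rfl⟩ | ⟨h, -⟩ | ⟨h, -⟩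
        · exact Or.inr (hpar.mem t)
        · exact Or.inl h
        · exact Or.inl h
    have hop : IsOpen (insert v p.1) := by
      refine isOpen_iff_mem_nhds.2 fun x hx => ?_
      rcases hx with rfl | hx
      · rwa [← hedge, union_self] at hnhds
      · exact mem_of_superset ((D.isOpen_edge hp).mem_nhds hx) (subset_insert _ _)
    have huniv : insert v p.1 = univ :=
      IsClopen.eq_univ ⟨hcl, hop⟩ ⟨v, mem_insert _ _⟩
    have hV : V = {v} := by
      refine Subset.antisymm (fun x hx => ?_) (singleton_subset_iff.2 hv)
      have : x ∈ insert v p.1 := huniv ▸ mem_univ x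
      exact this.resolve_right fun h => D.notMem_vertices hp h hx
    have hE : E = {p.1} := by
      refine Subset.antisymm (fun e he => ?_) (singleton_subset_iff.2 hp)
      obtain ⟨ψ', a', b', h'⟩ := D.exists_param e he
      have : ψ' 0 ∈ insert v p.1 := huniv ▸ mem_univ _
      rcases this with h | h
      · exact absurd (h ▸ hv) (D.notMem_vertices he (h'.mem 0))
      · exact D.eq_of_mem he hp (h'.mem 0) h
    exact ⟨V, E, D, Or.inr ⟨v, p.1, orient ψ p, hV, hE, hV ▸ hpar⟩⟩
  · have h1 := hz p hp
    rw [(hends p hp).2 (Or.inl rfl)] at h1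
    have h2 := (hz q hq).neg
    rw [(hends q hq).2 (Or.inr rfl)] at h2
    have hflip : ∀ r : Set X × Bool, r ≠ (r.1, !r.2) := by
      rintro ⟨e, _ | _⟩ h <;> simp at h
    -- Only `p` and `q` end at `v`, so the far ends of their edges and all ends of the other edges
    -- survive as vertices.
    have D' := D.merge hp hq hedge h1 h2
      (fun h => by
        rcases (hends (p.1, !p.2) hp).1 h with h | h
        · exact hflip p h.symm
        · exact hedge (show (p.1, !p.2).1 = q.1 from congrArg Prod.fst h))
      (fun h => by
        rcases (hends (q.1, !q.2) hq).1 h with h | h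
        · exact hedge (show (q.1, !q.2).1 = p.1 from congrArg Prod.fst h).symm
        · exact hflip q h.symm)
      (fun e he h1 h2 => ⟨_, _, _, hz (e, true) he, fun h => by
        rcases (hends (e, false) he).1 h with h | h
        · exact h1 (congrArg Prod.fst h)
        · exact h2 (congrArg Prod.fst h), fun h => by
        rcases (hends (e, true) he).1 h with h | h
        · exact h1 (congrArg Prod.fst h)
        · exact h2 (congrArg Prod.fst h)⟩)
    refine ih _ ?_ D' rfl
    rw [← hn]
    exact ncard_sdiff_singleton_lt_of_mem hv D.finite_vertices

/-! ### Homogeneity of the circle -/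

/-- A space consisting of one vertex and one edge is homogeneous. -/
theorem exists_homeomorph_of_loop [T2Space X] {v : X} {e : Set X} (D : IsDecomp {v} {e})
    {ψ : ℝ → X} (h : IsParam {v} e ψ v v) (x y : X) : ∃ f : X ≃ₜ X, f x = y := by
  classical
  have he : e ∈ ({e} : Set (Set X)) := rfl
  have hve : v ∉ e := fun hv => D.notMem_vertices he hv rfl
  have hne : ∀ t, ψ t ≠ v := fun t ht => hve (ht ▸ h.mem t)
  have hcases : ∀ x, x = v ∨ ∃ t, x = ψ t := by
    intro x
    rcases D.mem_or x with hx | ⟨e', rfl, hx⟩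
    · exact Or.inl hx
    · rw [← h.range_eq] at hx
      obtain ⟨t, rfl⟩ := hx
      exact Or.inr ⟨t, rfl⟩
  have hlim : Tendsto ψ (Bornology.cobounded ℝ) (𝓝 v) := by
    rw [Metric.cobounded_eq_cocompact, cocompact_eq_atBot_atTop]
    exact h.tendsto_atBot.sup h.tendsto_atTop
  -- With `v` regarded as the point at infinity, inversion `t ↦ t⁻¹` exchanges it with `ψ 0`;
  -- translations along the edge take care of the other points.
  have hJ : ∃ J : X → X, J v = ψ 0 ∧ J (ψ 0) = v ∧ ∀ t ≠ 0, J (ψ t) = ψ t⁻¹ := by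
    have hex : ∀ x, ∃ y, (x = v → y = ψ 0) ∧ (x = ψ 0 → y = v) ∧ ∀ t ≠ 0, x = ψ t → y = ψ t⁻¹ := by
      intro x
      rcases hcases x with rfl | ⟨t, rfl⟩
      · exact ⟨ψ 0, fun _ => rfl, fun h => absurd h.symm (hne 0),
          fun t _ ht => absurd ht.symm (hne t)⟩
      · by_cases ht : t = 0
        · subst ht
          exact ⟨v, fun h => absurd h (hne 0), fun _ => rfl,
            fun s hs hs' => absurd (h.injective hs').symm hs⟩
        · exact ⟨ψ t⁻¹, fun h => absurd h (hne t), fun h' => absurd (h.injective h') ht,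
            fun s hs hs' => by rw [h.injective hs']⟩
    choose J h1 h2 h3 using hex
    exact ⟨J, h1 _ rfl, h2 _ rfl, fun t ht => h3 _ t ht rfl⟩
  obtain ⟨J, hJv, hJ0, hJt⟩ := hJ
  have hinv : ∀ x, J (J x) = x := by
    intro x
    rcases hcases x with rfl | ⟨t, rfl⟩
    · rw [hJv, hJ0]
    · by_cases ht : t = 0
      · rw [ht, hJ0, hJv]
      · rw [hJt t ht, hJt _ (inv_ne_zero ht), inv_inv]
  have hJc : Continuous J := by
    refine continuous_iff_ultrafilter.2 fun x F hFx => ?_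
    have hFc : {v} ∪ range ψ ∈ F := by
      refine mem_of_superset univ_mem fun x _ => ?_
      rcases hcases x with rfl | ⟨t, rfl⟩
      exacts [Or.inl rfl, Or.inr ⟨t, rfl⟩]
    rcases Ultrafilter.union_mem_iff.1 hFc with hF | hF
    · obtain rfl : x = v := by
        rw [← mem_singleton_iff, ← isClosed_singleton.closure_eq]
        exact mem_closure_iff_ultrafilter.2 ⟨F, hF, hFx⟩
      refine Tendsto.congr' ?_ (tendsto_const_nhds)
      filter_upwards [hF] with y hy using by rw [mem_singleton_iff.1 hy]
    · rw [← image_univ] at hF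
      let W := Ultrafilter.ofComapInfPrincipal hF
      have hW : W.map ψ = F := Ultrafilter.ofComapInfPrincipal_eq_of_map hF
      have hWx : Tendsto ψ W (𝓝 x) := by
        rw [← hW] at hFx; exact hFx
      rw [← hW, Ultrafilter.coe_map, tendsto_map'_iff]
      have hcob : (W : Filter ℝ) ≤ Bornology.cobounded ℝ → Tendsto (J ∘ ψ) W (𝓝 (J x)) := by
        intro h1
        obtain rfl : x = v := tendsto_nhds_unique hWx (hlim.mono_left h1)
        rw [hJv]
        have h2 : Tendsto (fun t : ℝ => ψ t⁻¹) W (𝓝 (ψ 0)) :=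
          (h.continuous.tendsto 0).comp (tendsto_inv₀_cobounded.mono_left h1)
        refine h2.congr' ?_
        filter_upwards [h1 (Bornology.isBounded_singleton (x := (0 : ℝ)))] with t ht
          using (hJt t ht).symm
      have hcc : Bornology.cobounded ℝ = atBot ⊔ atTop := by
        rw [Metric.cobounded_eq_cocompact, cocompact_eq_atBot_atTop]
      rcases ultrafilter_real_cases W with h1 | h1 | ⟨t, h1⟩
      · exact hcob (hcc ▸ h1.trans le_sup_left)
      · exact hcob (hcc ▸ h1.trans le_sup_right)
      · obtain rfl : x = ψ t := tendsto_nhds_unique hWx ((h.continuous.tendsto t).mono_left h1)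
        by_cases ht : t = 0
        · subst ht
          rw [hJ0]
          -- Since `0⁻¹ = 0` in Lean, the principal ultrafilter at `0` is treated apart; otherwise
          -- `t⁻¹` escapes to infinity and `ψ t⁻¹` tends to `v`.
          by_cases h0 : {(0 : ℝ)} ∈ W
          · refine Tendsto.congr' ?_ tendsto_const_nhds
            filter_upwards [h0] with s hs using by
              rw [mem_singleton_iff.1 hs, Function.comp_apply, hJ0]
          · have h0' : {(0 : ℝ)}ᶜ ∈ W := Ultrafilter.compl_mem_iff_notMem.2 h0
            have h2 : (W : Filter ℝ) ≤ 𝓝[≠] 0 := le_inf h1 (le_principal_iff.2 h0')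
            refine (hlim.comp (tendsto_inv₀_nhdsNE_zero.mono_left h2)).congr' ?_
            filter_upwards [h0'] with s hs using (hJt s hs).symm
        · rw [hJt t ht]
          have h2 : Tendsto (fun t : ℝ => ψ t⁻¹) W (𝓝 (ψ t⁻¹)) :=
            (h.continuous.tendsto _).comp ((tendsto_inv₀ ht).mono_left h1)
          refine h2.congr' ?_
          filter_upwards [h1 (isOpen_ne.mem_nhds ht)] with s hs using (hJt s hs).symm
  let J' : X ≃ₜ X := ⟨⟨J, J, hinv, hinv⟩, hJc, hJc⟩
  have hto : ∀ x, ∃ f : X ≃ₜ X, f x = v := by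
    intro x
    rcases hcases x with rfl | ⟨t, rfl⟩
    · exact ⟨Homeomorph.refl X, rfl⟩
    · obtain ⟨C, -, hC⟩ := D.exists_homeomorph_extension (ψ := fun _ => ψ) (a := fun _ => v)
        (b := fun _ => v) (fun e' he' => by rw [mem_singleton_iff.1 he']; exact h)
        (fun _ => OrderIso.addRight (-t))
      refine ⟨C.trans J', ?_⟩
      change J (C (ψ t)) = v
      rw [hC e he]
      simpa using hJ0
  obtain ⟨f, hf⟩ := hto x
  obtain ⟨g, hg⟩ := hto y
  exact ⟨f.trans g.symm, by rw [Homeomorph.trans_apply, hf, ← hg, Homeomorph.symm_apply_apply]⟩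

/-! ### Rank preserving homeomorphisms -/

/-- The homeomorphisms of `X` preserving a function `F`. -/
def preserving {α : Type*} (F : X → α) : Subgroup (X ≃ₜ X) where
  carrier := {f | ∀ x, F (f x) = F x}
  one_mem' _ := rfl
  mul_mem' {f g} hf hg x := (hf (g x)).trans (hg x)
  inv_mem' {f} hf x := by
    have := hf (f.symm x)
    rw [f.apply_symm_apply] at this
    exact this.symm

theorem mem_preserving {α : Type*} {F : X → α} {f : X ≃ₜ X} :
    f ∈ preserving F ↔ ∀ x, F (f x) = F x := Iff.rfl

theorem mem_orbit_preserving {α : Type*} {F : X → α} {x y : X} :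
    x ∈ MulAction.orbit (preserving F) y ↔ ∃ f ∈ preserving F, f y = x := by
  constructor
  · rintro ⟨f, rfl⟩
    exact ⟨f.1, f.2, rfl⟩
  · rintro ⟨f, hf, rfl⟩
    exact ⟨⟨f, hf⟩, rfl⟩

namespace IsDecomp

theorem exists_rank (D : IsDecomp V E) {ψ : Set X → ℝ → X} {a b : Set X → X}
    (hψ : ∀ e ∈ E, IsParam V e (ψ e) (a e) (b e)) (κ : Set X → ℕ) :
    ∃ ρ : X → ℕ, (∀ v ∈ V, ρ v = 0) ∧ ∀ e ∈ E, ∀ t, ρ (ψ e t) = nestedRank (κ e) t := by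
  have hex : ∀ x, ∃ y, (x ∈ V → y = 0) ∧ ∀ e ∈ E, ∀ t, x = ψ e t → y = nestedRank (κ e) t := by
    intro x
    rcases D.cases hψ x with hx | ⟨e, he, t, rfl⟩
    · refine ⟨0, fun _ => rfl, fun e he t hxt => ?_⟩
      exact absurd hx (D.notMem_vertices he (hxt ▸ (hψ e he).mem t))
    · refine ⟨nestedRank (κ e) t,
        fun hx => absurd hx (D.notMem_vertices he ((hψ e he).mem t)), fun e' he' s hs => ?_⟩
      obtain rfl := D.eq_of_mem he he' ((hψ e he).mem t) (hs ▸ (hψ e' he').mem s)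
      rw [(hψ e he).injective hs]
  choose ρ hV hE using hex
  exact ⟨ρ, fun v hv => hV v hv, fun e he t => hE _ e he t rfl⟩

variable [T2Space X]

/-- Away from the vertices the space is a disjoint union of open edges, so a connected set cannot
pass from one edge to another. -/
theorem subset_edge (D : IsDecomp V E) {S : Set X} (hS : IsPreconnected S) (hSV : Disjoint S V)
    {e : Set X} (he : e ∈ E) {x : X} (hx : x ∈ S) (hxe : x ∈ e) : S ⊆ e := by
  refine IsPreconnected.subset_left_of_subset_union (D.isOpen_edge he)
    (v := ⋃ e' ∈ E \ {e}, e') (isOpen_biUnion fun e' he' => D.isOpen_edge he'.1) ?_ ?_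
    ⟨x, hx, hxe⟩ hS
  · refine Set.disjoint_left.2 fun y hy hy' => ?_
    obtain ⟨e', he', hye'⟩ := mem_iUnion₂.1 hy'
    exact he'.2 (D.eq_of_mem he'.1 he hye' hy)
  · intro y hy
    obtain ⟨e', he', hye'⟩ := (D.mem_or y).resolve_left (Set.disjoint_left.1 hSV hy)
    by_cases h : e' = e
    · exact Or.inl (h ▸ hye')
    · exact Or.inr (mem_biUnion (show e' ∈ E \ {e} from ⟨he', h⟩) hye')

/-- A homeomorphism preserving the vertices permutes the edges. -/
theorem image_mem_edges (D : IsDecomp V E) {f : X ≃ₜ X} (hf : f ∈ preserving (· ∈ V))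
    {e : Set X} (he : e ∈ E) : f '' e ∈ E := by
  have key : ∀ g ∈ preserving (X := X) (· ∈ V), ∀ e ∈ E, ∀ x ∈ e, ∀ e' ∈ E,
      g x ∈ e' → g '' e ⊆ e' := by
    intro g hg e he x hx e' he' hxe'
    obtain ⟨ψ, a, b, hψ⟩ := D.exists_param e he
    refine D.subset_edge (hψ.isPreconnected.image g g.continuous.continuousOn) ?_ he'
      ⟨x, hx, rfl⟩ hxe'
    refine Set.disjoint_left.2 ?_
    rintro _ ⟨y, hy, rfl⟩ hyV
    exact D.notMem_vertices he hy ((mem_preserving.1 hg y).mp hyV)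
  obtain ⟨ψ, a, b, hψ⟩ := D.exists_param e he
  have h0 : f (ψ 0) ∉ V := fun h =>
    D.notMem_vertices he (hψ.mem 0) ((mem_preserving.1 hf _).mp h)
  obtain ⟨e', he', h1⟩ := (D.mem_or (f (ψ 0))).resolve_left h0
  have h2 := key f hf e he _ (hψ.mem 0) e' he' h1
  have h3 := key f⁻¹ (inv_mem hf) e' he' _ h1 e he (by
    change f.symm (f (ψ 0)) ∈ e
    rw [f.symm_apply_apply]; exact hψ.mem 0)
  have : f '' e = e' := by
    refine h2.antisymm fun y hy => ⟨f.symm y, h3 ⟨y, hy, rfl⟩, f.apply_symm_apply y⟩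
  exact this ▸ he'

/-- A homeomorphism preserving the vertices can be straightened on the edges so as to preserve a
rank that is symmetric on the edges. -/
theorem exists_straighten (D : IsDecomp V E) {ψ : Set X → ℝ → X} {a b : Set X → X}
    (hψ : ∀ e ∈ E, IsParam V e (ψ e) (a e) (b e)) {κ : Set X → ℕ} {ρ : X → ℕ}
    (hρV : ∀ v ∈ V, ρ v = 0) (hρE : ∀ e ∈ E, ∀ t, ρ (ψ e t) = nestedRank (κ e) t)
    {f : X ≃ₜ X} (hf : f ∈ preserving (· ∈ V)) (hκ : ∀ e ∈ E, κ (f '' e) = κ e) :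
    ∃ g ∈ preserving (fun x => (x ∈ V, ρ x)), (∀ v ∈ V, g v = f v) ∧
      ∀ e ∈ E, ∀ x ∈ e, g x ∈ f '' e := by
  have hfV : ∀ x, f x ∈ V ↔ x ∈ V := fun x => Iff.of_eq (hf x)
  have hc : ∀ e, ∃ c : ℝ ≃o ℝ, e ∈ E → (∀ t, f (ψ e (c t)) = ψ (f '' e) t) ∨
      ∀ t, f (ψ e (c t)) = ψ (f '' e) (-t) := by
    intro e
    by_cases he : e ∈ E
    · have h := hψ e he
      have h' : IsParam V (f '' e) (f ∘ ψ e) (f (a e)) (f (b e)) :=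
        ⟨f.continuous.comp h.1, f.injective.comp h.2, by rw [range_comp, h.3],
          (f.continuous.tendsto _).comp h.4, (f.continuous.tendsto _).comp h.5,
          (hfV _).2 h.6, (hfV _).2 h.7⟩
      have he' := D.image_mem_edges hf he
      -- The edge `f '' e` has its chosen parametrization and the one transported by `f`. Correcting
      -- by their difference makes `f` act on parameters as the identity or as negation, both of
      -- which preserve ranks.
      obtain ⟨c, hc⟩ := D.exists_orderIso_param he' (hψ _ he') h'
      exact ⟨c, fun _ => hc⟩
    · exact ⟨OrderIso.refl ℝ, fun h => absurd h he⟩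
  choose c hc using hc
  obtain ⟨C, hCV, hCE⟩ := D.exists_homeomorph_extension hψ c
  have hgV : ∀ v ∈ V, (C.trans f) v = f v := fun v hv => by
    rw [Homeomorph.trans_apply, hCV v hv]
  have hgE : ∀ e ∈ E, ∀ t, ∃ s, (C.trans f) (ψ e t) = ψ (f '' e) s ∧ (s = t ∨ s = -t) := by
    intro e he t
    rw [Homeomorph.trans_apply, hCE e he]
    rcases hc e he with h | h
    · exact ⟨t, h t, Or.inl rfl⟩
    · exact ⟨-t, h t, Or.inr rfl⟩
  refine ⟨C.trans f, fun x => ?_, hgV, fun e he x hx => ?_⟩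
  · rcases D.cases hψ x with hx | ⟨e, he, t, rfl⟩
    · rw [hgV x hx]
      have : f x ∈ V := (hfV x).2 hx
      simp [hx, this, hρV]
    · obtain ⟨s, hs, hst⟩ := hgE e he t
      have he' := D.image_mem_edges hf he
      have h1 : ψ (f '' e) s ∉ V := D.notMem_vertices he' ((hψ _ he').mem s)
      have h2 : ψ e t ∉ V := D.notMem_vertices he ((hψ _ he).mem t)
      rw [hs]
      refine Prod.ext (by simp [h1, h2]) ?_
      change ρ _ = ρ _
      rw [hρE _ he', hρE e he, hκ e he]
      rcases hst with rfl | rfl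
      exacts [rfl, nestedRank_neg _ _]
  · rw [← (hψ e he).range_eq] at hx
    obtain ⟨t, rfl⟩ := hx
    obtain ⟨s, hs, -⟩ := hgE e he t
    rw [hs]
    exact (hψ _ (D.image_mem_edges hf he)).mem s

/-- Points in one orbit of the vertex preserving homeomorphisms which have equal ranks lie in one
orbit of the rank preserving homeomorphisms. -/
theorem exists_rank_preserving (D : IsDecomp V E) {ψ : Set X → ℝ → X} {a b : Set X → X}
    (hψ : ∀ e ∈ E, IsParam V e (ψ e) (a e) (b e)) {κ : Set X → ℕ} {ρ : X → ℕ}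
    (hρV : ∀ v ∈ V, ρ v = 0) (hρE : ∀ e ∈ E, ∀ t, ρ (ψ e t) = nestedRank (κ e) t)
    {f : X ≃ₜ X} (hf : f ∈ preserving (· ∈ V)) (hκ : ∀ e ∈ E, κ (f '' e) = κ e) {x : X}
    (hx : ρ (f x) = ρ x) : ∃ g ∈ preserving (fun x => (x ∈ V, ρ x)), g x = f x := by
  classical
  obtain ⟨g, hg, hgV, hgE⟩ := D.exists_straighten hψ hρV hρE hf hκ
  rcases D.mem_or x with hxV | ⟨e, he, hxe⟩
  · exact ⟨g, hg, hgV x hxV⟩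
  have he' := D.image_mem_edges hf he
  obtain ⟨s, hs⟩ : ∃ s, ψ (f '' e) s = g x := by
    have := hgE e he x hxe
    rwa [← (hψ _ he').range_eq] at this
  obtain ⟨t, ht⟩ : ∃ t, ψ (f '' e) t = f x := by
    have := mem_image_of_mem f hxe
    rwa [← (hψ _ he').range_eq] at this
  have hst : nestedRank (κ (f '' e)) s = nestedRank (κ (f '' e)) t := by
    rw [← hρE _ he', ← hρE _ he', hs, ht, hx]
    exact congrArg Prod.snd (hg x)
  -- The straightened map puts `x` on the right edge with the right rank; a rank preserving motion
  -- of that edge alone carries `g x` to `f x`.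
  obtain ⟨c, hc, hcs⟩ := exists_orderIso_nestedRank hst
  obtain ⟨C, hCV, hCE⟩ := D.exists_homeomorph_extension hψ
    (fun e' => if e' = f '' e then c else OrderIso.refl ℝ)
  have hC : C ∈ preserving (fun x => (x ∈ V, ρ x)) := by
    intro y
    rcases D.cases hψ y with hy | ⟨e', he1, r, rfl⟩
    · rw [hCV y hy]
    · have h1 : ∀ t, ψ e' t ∉ V := fun t => D.notMem_vertices he1 ((hψ _ he1).mem t)
      rw [hCE e' he1]
      refine Prod.ext (by simp [h1]) ?_
      change ρ _ = ρ _
      rw [hρE _ he1, hρE _ he1]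
      by_cases h : e' = f '' e
      · rw [if_pos h, h, hc]
      · rw [if_neg h]; rfl
  refine ⟨C * g, mul_mem hC hg, ?_⟩
  change C (g x) = f x
  rw [← hs, hCE _ he', if_pos rfl, hcs, ht]

/-- The points of one edge lie in one orbit of the vertex preserving homeomorphisms. -/
theorem exists_preserving_of_mem_edge (D : IsDecomp V E) {e : Set X} (he : e ∈ E) {x y : X}
    (hx : x ∈ e) (hy : y ∈ e) : ∃ f ∈ preserving (X := X) (· ∈ V), f x = y := by
  obtain ⟨ψ₀, a₀, b₀, -⟩ := D.exists_param e he
  have hex : ∀ e, ∃ ψ a b, e ∈ E → IsParam V e ψ a b := by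
    intro e
    by_cases he : e ∈ E
    · obtain ⟨ψ, a, b, h⟩ := D.exists_param e he
      exact ⟨ψ, a, b, fun _ => h⟩
    · exact ⟨ψ₀, a₀, b₀, fun h => absurd h he⟩
  choose ψ a b hψ using hex
  rw [← (hψ e he).range_eq] at hx hy
  obtain ⟨s, rfl⟩ := hx
  obtain ⟨t, rfl⟩ := hy
  obtain ⟨C, hCV, hCE⟩ := D.exists_homeomorph_extension hψ fun _ => OrderIso.addRight (t - s)
  refine ⟨C, fun y => ?_, by rw [hCE e he]; simp⟩
  rcases D.cases hψ y with hy | ⟨e', he', r, rfl⟩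
  · rw [hCV y hy]
  · have h1 : ∀ t, ψ e' t ∉ V := fun t => D.notMem_vertices he' ((hψ _ he').mem t)
    rw [hCE e' he']
    simp [h1]

theorem finite_orbits (D : IsDecomp V E) :
    Finite (MulAction.orbitRel.Quotient (preserving (X := X) (· ∈ V)) X) := by
  have hne : ∀ e : E, ∃ x, x ∈ (e : Set X) := fun e => by
    obtain ⟨ψ, a, b, h⟩ := D.exists_param e e.2
    exact ⟨_, h.mem 0⟩
  choose m hm using hne
  have := D.finite_vertices.to_subtype
  have := D.finite_edges.to_subtype
  refine Finite.of_surjective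
    (fun i : V ⊕ E => (Quotient.mk _ (i.elim Subtype.val m) :
      MulAction.orbitRel.Quotient (preserving (X := X) (· ∈ V)) X)) fun q => ?_
  obtain ⟨x, rfl⟩ := Quotient.mk_surjective q
  rcases D.mem_or x with hx | ⟨e, he, hx⟩
  · exact ⟨Sum.inl ⟨x, hx⟩, rfl⟩
  · exact ⟨Sum.inr ⟨e, he⟩, Quotient.sound
      (mem_orbit_preserving.2 (D.exists_preserving_of_mem_edge he hx (hm ⟨e, he⟩)))⟩

theorem isOpen_orbit (D : IsDecomp V E) {x : X} (hx : x ∉ V) :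
    IsOpen (MulAction.orbit (preserving (X := X) (· ∈ V)) x) := by
  refine isOpen_iff_mem_nhds.2 fun y hy => ?_
  obtain ⟨f, hf, rfl⟩ := mem_orbit_preserving.1 hy
  have hy : f x ∉ V := fun h => hx ((mem_preserving.1 hf x).mp h)
  obtain ⟨e, he, hye⟩ := (D.mem_or (f x)).resolve_left hy
  refine mem_of_superset ((D.isOpen_edge he).mem_nhds hye) fun w hw => ?_
  obtain ⟨g, hg, rfl⟩ := D.exists_preserving_of_mem_edge he hye hw
  exact mem_orbit_preserving.2 ⟨g * f, mul_mem hg hf, rfl⟩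

end IsDecomp

/-! ### Counting orbits of rank preserving groups -/

namespace IsDecomp

variable [T2Space X]

/-- An orbit of the smaller group is determined by its `K`-orbit and its rank. Rank `0` occurs in
every `K`-orbit and positive ranks only in that of `e₀`, where all values up to `κ e₀` are attained.
This gives `κ e₀` additional orbits. -/
theorem height_preserving_rank (D : IsDecomp V E) {ψ : Set X → ℝ → X} {a b : Set X → X}
    (hψ : ∀ e ∈ E, IsParam V e (ψ e) (a e) (b e)) {κ : Set X → ℕ} {ρ : X → ℕ}
    (hρV : ∀ v ∈ V, ρ v = 0) (hρE : ∀ e ∈ E, ∀ t, ρ (ψ e t) = nestedRank (κ e) t)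
    (hκ : ∀ f ∈ preserving (X := X) (· ∈ V), ∀ e ∈ E, κ (f '' e) = κ e)
    {e₀ : Set X} (he₀ : e₀ ∈ E)
    (hκ' : ∀ e ∈ E, (∀ f ∈ preserving (X := X) (· ∈ V), f '' e₀ ≠ e) → κ e = 0) :
    height (preserving (fun x => (x ∈ V, ρ x))) (univ : Set X) + 1 =
      Nat.card (MulAction.orbitRel.Quotient (preserving (X := X) (· ∈ V)) X) + κ e₀ := by
  set K := preserving (X := X) (· ∈ V) with hK
  set G := preserving (fun x => (x ∈ V, ρ x)) with hG
  have hGK : ∀ f ∈ G, f ∈ K := fun f hf x => congrArg Prod.fst (hf x)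
  have hGρ : ∀ f ∈ G, ∀ x, ρ (f x) = ρ x := fun f hf x => congrArg Prod.snd (hf x)
  have horb : ∀ x y, x ∈ MulAction.orbit G y ↔ x ∈ MulAction.orbit K y ∧ ρ x = ρ y := by
    intro x y
    constructor
    · intro h
      obtain ⟨f, hf, rfl⟩ := mem_orbit_preserving.1 h
      exact ⟨mem_orbit_preserving.2 ⟨f, hGK f hf, rfl⟩, hGρ f hf y⟩
    · rintro ⟨h, hxy⟩
      obtain ⟨f, hf, rfl⟩ := mem_orbit_preserving.1 h
      obtain ⟨g, hg, hgy⟩ := D.exists_rank_preserving hψ hρV hρE hf (hκ f hf) hxy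
      exact mem_orbit_preserving.2 ⟨g, hg, hgy⟩
  have hKV : ∀ f ∈ K, ∀ x, f x ∈ V ↔ x ∈ V := fun f hf x => Iff.of_eq (hf x)
  have hKinv : ∀ (x : X) (g : G), ∀ w ∈ MulAction.orbit K x, g • w ∈ MulAction.orbit K x := by
    intro x g w hw
    obtain ⟨f, hf, rfl⟩ := mem_orbit_preserving.1 hw
    exact mem_orbit_preserving.2 ⟨g.1 * f, mul_mem (hGK _ g.2) hf, rfl⟩
  have hsep : ∀ x y : X, x ∉ MulAction.orbit G y → ∃ U : Set X, IsOpen U ∧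
      (∀ (g : G), ∀ w ∈ U, g • w ∈ U) ∧ ¬ (x ∈ U ↔ y ∈ U) := by
    intro x y hxy
    rw [horb] at hxy
    by_cases hK' : x ∈ MulAction.orbit K y
    · have hρ : ρ x ≠ ρ y := fun h => hxy ⟨hK', h⟩
      obtain ⟨f, hf, rfl⟩ := mem_orbit_preserving.1 hK'
      have hy : y ∉ V := fun h => hρ (by rw [hρV _ ((hKV f hf y).2 h), hρV y h])
      have hx : f y ∉ V := fun h => hy ((hKV f hf y).1 h)
      -- Off the vertices the lower level sets of the rank are open, and this threshold admits
      -- exactly one of the two points.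
      refine ⟨{w | w ∉ V ∧ ρ w ≤ min (ρ (f y)) (ρ y)}, ?_, ?_, ?_⟩
      · have : {w | w ∉ V ∧ ρ w ≤ min (ρ (f y)) (ρ y)} =
            ⋃ e ∈ E, ψ e '' {t | nestedRank (κ e) t ≤ min (ρ (f y)) (ρ y)} := by
          ext w
          simp only [mem_iUnion, exists_prop]
          constructor
          · rintro ⟨hw, hw'⟩
            obtain ⟨e, he, t, rfl⟩ := (D.cases hψ w).resolve_left hw
            exact ⟨e, he, t, (hρE e he t).symm.trans_le hw', rfl⟩
          · rintro ⟨e, he, t, ht, rfl⟩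
            exact ⟨D.notMem_vertices he ((hψ e he).mem t), (hρE e he t).trans_le ht⟩
        rw [this]
        exact isOpen_biUnion fun e he => D.isOpen_image he (hψ e he) (isOpen_nestedRank_le _ _)
      · rintro g w ⟨hw, hw'⟩
        exact ⟨fun h => hw ((hKV _ (hGK _ g.2) w).1 h), (hGρ _ g.2 w).symm ▸ hw'⟩
      · intro h
        have h' : ρ (f y) ≤ min (ρ (f y)) (ρ y) ↔ ρ y ≤ min (ρ (f y)) (ρ y) :=
          ⟨fun h1 => (h.1 ⟨hx, h1⟩).2, fun h1 => (h.2 ⟨hy, h1⟩).2⟩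
        omega
    · have hK'' : y ∉ MulAction.orbit K x := fun h => hK' (MulAction.orbit_eq_iff.2 h ▸
        MulAction.mem_orbit_self x)
      by_cases hy : y ∈ V
      · by_cases hx : x ∈ V
        · refine ⟨(MulAction.orbit K x)ᶜ, ?_, ?_, fun h => ?_⟩
          · refine (D.finite_vertices.subset fun w hw => ?_).isClosed.isOpen_compl
            obtain ⟨f, hf, rfl⟩ := mem_orbit_preserving.1 hw
            exact (hKV f hf x).2 hx
          · intro g w hw hgw
            refine hw ?_
            have := hKinv x g⁻¹ _ hgw
            rwa [inv_smul_smul] at this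
          · exact h.2 hK'' (MulAction.mem_orbit_self x)
        · exact ⟨MulAction.orbit K x, D.isOpen_orbit hx, hKinv x,
            fun h => hK'' (h.1 (MulAction.mem_orbit_self x))⟩
      · exact ⟨MulAction.orbit K y, D.isOpen_orbit hy, hKinv y,
          fun h => hK' (h.2 (MulAction.mem_orbit_self y))⟩
  let QK := MulAction.orbitRel.Quotient K X
  let QG := MulAction.orbitRel.Quotient G X
  let π : X → QK := Quotient.mk _
  have hπ : ∀ x y, π x = π y ↔ x ∈ MulAction.orbit K y := fun x y => Quotient.eq
  let Φ : QG → QK × ℕ := Quotient.lift (fun x => (π x, ρ x)) fun x y hxy =>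
    have h := (horb x y).1 hxy
    Prod.ext ((hπ x y).2 h.1) h.2
  have hΦ : Function.Injective Φ := by
    intro p q
    obtain ⟨x, rfl⟩ := Quotient.mk_surjective p
    obtain ⟨y, rfl⟩ := Quotient.mk_surjective q
    intro h
    exact Quotient.sound ((horb x y).2 ⟨(hπ x y).1 (congrArg Prod.fst h), congrArg Prod.snd h⟩)
  obtain ⟨x₀, hx₀⟩ : ∃ x₀, x₀ ∈ e₀ := ⟨_, (hψ e₀ he₀).mem 0⟩
  have hedge : ∀ e ∈ E, ∀ x ∈ e, ∀ j ≤ κ e, (π x, j) ∈ range Φ := by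
    intro e he x hx j hj
    obtain ⟨t, ht⟩ := exists_nestedRank_eq hj
    refine ⟨Quotient.mk _ (ψ e t), Prod.ext ((hπ _ _).2 ?_) ((hρE e he t).trans ht)⟩
    exact mem_orbit_preserving.2 (D.exists_preserving_of_mem_edge he hx ((hψ e he).mem t))
  have hrange : range Φ = (univ ×ˢ {0}) ∪ ({π x₀} ×ˢ Icc 1 (κ e₀)) := by
    refine Subset.antisymm ?_ (union_subset ?_ ?_)
    · rintro _ ⟨q, rfl⟩
      obtain ⟨x, rfl⟩ := Quotient.mk_surjective q
      change (π x, ρ x) ∈ _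
      by_cases h0 : ρ x = 0
      · exact Or.inl ⟨mem_univ _, h0⟩
      · right
        rcases D.cases hψ x with hx | ⟨e, he, t, rfl⟩
        · exact absurd (hρV x hx) h0
        · have h1 : ρ (ψ e t) ≤ κ e := hρE e he t ▸ nestedRank_le _ _
          have h2 : ∃ f ∈ K, f '' e₀ = e := by
            by_contra! h
            have := hκ' e he h
            omega
          obtain ⟨f, hf, rfl⟩ := h2
          rw [hκ f hf e₀ he₀] at h1
          refine ⟨(hπ _ _).2 ?_, Nat.one_le_iff_ne_zero.2 h0, h1⟩
          obtain ⟨g, hg, hgx⟩ := D.exists_preserving_of_mem_edge he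
            (mem_image_of_mem f hx₀) ((hψ _ he).mem t)
          exact mem_orbit_preserving.2 ⟨g * f, mul_mem hg hf, hgx⟩
    · rintro ⟨q, j⟩ ⟨-, hj⟩
      obtain rfl : j = 0 := hj
      obtain ⟨x, rfl⟩ := Quotient.mk_surjective q
      rcases D.mem_or x with hx | ⟨e, he, hx⟩
      · exact ⟨Quotient.mk _ x, Prod.ext rfl (hρV x hx)⟩
      · exact hedge e he x hx 0 (Nat.zero_le _)
    · rintro ⟨q, j⟩ ⟨hq, hj⟩
      obtain rfl : q = π x₀ := hq
      exact hedge e₀ he₀ x₀ hx₀ j hj.2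
  have hfK : Finite QK := D.finite_orbits
  have hfin1 : ((univ : Set QK) ×ˢ ({0} : Set ℕ)).Finite := finite_univ.prod (finite_singleton 0)
  have hfin2 : (({π x₀} : Set QK) ×ˢ Icc 1 (κ e₀)).Finite :=
    (finite_singleton _).prod (finite_Icc _ _)
  have hfG : Finite QG := by
    have : Finite (range Φ) := hrange ▸ (hfin1.union hfin2).to_subtype
    exact Finite.of_injective_finite_range hΦ
  have hcard : Nat.card QG = Nat.card QK + κ e₀ := by
    rw [← Nat.card_range_of_injective hΦ, Nat.card_coe_set_eq, hrange,
      ncard_union_eq (Set.disjoint_left.2 ?_) hfin1 hfin2, ncard_prod, ncard_prod]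
    · simp [Set.ncard_univ, Set.ncard_eq_toFinset_card']
    · rintro ⟨q, j⟩ ⟨-, hj⟩ ⟨-, hj'⟩
      obtain rfl : j = 0 := hj
      exact absurd hj'.1 (by simp)
  have hne : Nonempty X := ⟨x₀⟩
  rw [height_add_one_eq_card hsep]
  exact_mod_cast hcard

/-- Subgroups of the group preserving the vertices realize all larger heights. -/
theorem exists_height_eq_add (D : IsDecomp V E) (hE : E.Nonempty) :
    height (preserving (X := X) (· ∈ V)) (univ : Set X) + 1 =
      Nat.card (MulAction.orbitRel.Quotient (preserving (X := X) (· ∈ V)) X) ∧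
    ∀ k : ℕ, ∃ G : Subgroup (X ≃ₜ X), height G (univ : Set X) =
      height (preserving (X := X) (· ∈ V)) (univ : Set X) + k := by
  classical
  obtain ⟨e₀, he₀⟩ := hE
  obtain ⟨ψ₀, a₀, b₀, -⟩ := D.exists_param e₀ he₀
  have hex : ∀ e, ∃ ψ a b, e ∈ E → IsParam V e ψ a b := by
    intro e
    by_cases he : e ∈ E
    · obtain ⟨ψ, a, b, h⟩ := D.exists_param e he
      exact ⟨ψ, a, b, fun _ => h⟩
    · exact ⟨ψ₀, a₀, b₀, fun h => absurd h he⟩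
  choose ψ a b hψ using hex
  set K := preserving (X := X) (· ∈ V)
  have key : ∀ k : ℕ, ∃ ρ : X → ℕ, (k = 0 → ∀ x, ρ x = 0) ∧
      height (preserving (fun x => (x ∈ V, ρ x))) (univ : Set X) + 1 =
        Nat.card (MulAction.orbitRel.Quotient K X) + k := by
    intro k
    -- All edges in the `K`-orbit of `e₀` must be marked alike, since the elements of `K` permute
    -- them.
    let κ : Set X → ℕ := fun e => if ∃ f ∈ K, f '' e₀ = e then k else 0
    obtain ⟨ρ, hρV, hρE⟩ := D.exists_rank hψ κ
    refine ⟨ρ, ?_, ?_⟩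
    · rintro rfl x
      rcases D.cases hψ x with hx | ⟨e, he, t, rfl⟩
      · exact hρV x hx
      · rw [hρE e he]
        simp [κ, nestedRank]
    · have hk : κ e₀ = k := if_pos ⟨1, one_mem K, image_id _⟩
      have h := D.height_preserving_rank hψ hρV hρE (κ := κ) ?_ he₀ ?_
      · rwa [hk] at h
      · intro f hf e he
        have : (∃ g ∈ K, g '' e₀ = f '' e) ↔ ∃ g ∈ K, g '' e₀ = e := by
          constructor
          · rintro ⟨g, hg, h⟩
            refine ⟨f⁻¹ * g, mul_mem (inv_mem hf) hg, ?_⟩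
            change (f.symm ∘ g) '' e₀ = e
            rw [image_comp, h, ← image_comp, f.symm_comp_self, image_id]
          · rintro ⟨g, hg, h⟩
            refine ⟨f * g, mul_mem hf hg, ?_⟩
            change (f ∘ g) '' e₀ = _
            rw [image_comp, h]
        simp only [κ, this]
      · intro e he h
        refine if_neg ?_
        rintro ⟨f, hf, hfe⟩
        exact h f hf hfe
  -- For `k = 0` the rank vanishes identically, and preserving it is no condition beyond preserving
  -- `V`.
  have h0 : height K (univ : Set X) + 1 = Nat.card (MulAction.orbitRel.Quotient K X) := by
    obtain ⟨ρ, hρ, h⟩ := key 0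
    rw [Nat.cast_zero, add_zero] at h
    rw [← h]
    congr 1
    refine height_congr (fun g => ⟨⟨g.1, fun x => ?_⟩, fun x => rfl⟩)
      (fun g => ⟨⟨g.1, fun x => congrArg Prod.fst (g.2 x)⟩, fun x => rfl⟩) _
    exact Prod.ext (g.2 x) ((hρ rfl _).trans (hρ rfl _).symm)
  refine ⟨h0, fun k => ?_⟩
  obtain ⟨ρ, -, h⟩ := key k
  refine ⟨preserving (fun x => (x ∈ V, ρ x)), ?_⟩
  rw [← h0, add_right_comm] at h
  exact (ENat.add_left_injective_of_ne_top ENat.one_ne_top) h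

end IsDecomp

/-! ### From topological graphs to the theorem -/

/-- The open edge of an arc. -/
theorem IsArc.exists_isParam {A : Set X} {a b : X} (h : IsArc A a b) (ha : a ∈ V) (hb : b ∈ V) :
    ∃ ψ, IsParam V (A \ {a, b}) ψ a b := by
  obtain ⟨φ, rfl, rfl⟩ := h
  have hc : Continuous fun t => (φ t : X) := continuous_subtype_val.comp φ.continuous
  have hi : Function.Injective fun t => (φ t : X) := Subtype.val_injective.comp φ.injective
  refine ⟨fun t => φ (unitInterval.sigmoid t), ?_, ?_, ?_, ?_, ?_, ha, hb⟩
  · exact hc.comp unitInterval.continuous_sigmoid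
  · exact hi.comp unitInterval.sigmoid_injective
  · change range ((fun t => (φ t : X)) ∘ unitInterval.sigmoid) = _
    rw [range_comp, unitInterval.range_sigmoid]
    ext x
    constructor
    · rintro ⟨t, ht, rfl⟩
      refine ⟨(φ t).2, ?_⟩
      rintro (h | h)
      · exact ht.1.ne' (hi h)
      · exact ht.2.ne (hi h)
    · rintro ⟨hx, hx'⟩
      obtain ⟨t, ht⟩ := φ.surjective ⟨x, hx⟩
      have ht' : (φ t : X) = x := congrArg Subtype.val ht
      refine ⟨t, ⟨unitInterval.pos_iff_ne_zero.2 ?_, unitInterval.lt_one_iff_ne_one.2 ?_⟩, ht'⟩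
      · rintro rfl
        exact hx' (Or.inl ht'.symm)
      · rintro rfl
        exact hx' (Or.inr ht'.symm)
  · exact (hc.tendsto 0).comp unitInterval.tendsto_sigmoid_atBot
  · exact (hc.tendsto 1).comp unitInterval.tendsto_sigmoid_atTop

theorem IsTopologicalGraph.infinite (h : IsTopologicalGraph X) : Infinite X := by
  obtain ⟨n, A, a, b, hA, hU, -⟩ := h.exists_arcs
  have := h.connectedSpace
  obtain ⟨x⟩ := (inferInstance : Nonempty X)
  obtain ⟨i, -⟩ := mem_iUnion.1 (hU ▸ mem_univ x : x ∈ ⋃ i, A i)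
  obtain ⟨φ, -⟩ := hA i
  have : Infinite unitInterval := Set.infinite_coe_iff.2 (Icc_infinite zero_lt_one)
  exact Infinite.of_injective (fun t => (φ t : X)) (Subtype.val_injective.comp φ.injective)

theorem IsTopologicalGraph.exists_isDecomp (h : IsTopologicalGraph X) :
    ∃ V E, IsDecomp (X := X) V E := by
  obtain ⟨n, A, a, b, hA, hU, hd⟩ := h.exists_arcs
  have hmem : ∀ i, a i ∈ A i ∧ b i ∈ A i := by
    intro i
    obtain ⟨φ, h0, h1⟩ := hA i
    exact ⟨h0 ▸ (φ 0).2, h1 ▸ (φ 1).2⟩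
  have hdisj : ∀ i j, ∀ x ∈ A i \ {a i, b i}, x ∈ A j → i = j := by
    intro i j x hx hxj
    by_contra hij
    exact hx.2 (hd i j hij ⟨hx.1, hxj⟩).1
  refine ⟨range a ∪ range b, range fun i => A i \ {a i, b i},
    (finite_range a).union (finite_range b), finite_range _, ?_, ?_, ?_⟩
  · rintro _ ⟨i, rfl⟩ _ ⟨j, rfl⟩ hij
    refine Set.disjoint_left.2 fun x hx hx' => hij ?_
    rw [hdisj i j x hx hx'.1]
  · ext x
    simp only [sUnion_range, mem_iUnion, mem_compl_iff]
    constructor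
    · rintro ⟨i, hi⟩ (⟨j, rfl⟩ | ⟨j, rfl⟩)
      · obtain rfl := hdisj i j _ hi (hmem j).1
        exact hi.2 (Or.inl rfl)
      · obtain rfl := hdisj i j _ hi (hmem j).2
        exact hi.2 (Or.inr rfl)
    · intro hx
      obtain ⟨i, hi⟩ := mem_iUnion.1 (hU ▸ mem_univ x : x ∈ ⋃ i, A i)
      refine ⟨i, hi, ?_⟩
      rintro (rfl | rfl)
      · exact hx (Or.inl ⟨i, rfl⟩)
      · exact hx (Or.inr ⟨i, rfl⟩)
  · rintro _ ⟨i, rfl⟩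
    obtain ⟨ψ, hψ⟩ := (hA i).exists_isParam (V := range a ∪ range b) (Or.inl ⟨i, rfl⟩)
      (Or.inr ⟨i, rfl⟩)
    exact ⟨ψ, _, _, hψ⟩

/-- All heights from that of the full homeomorphism group on are realized by subgroups. -/
theorem IsTopologicalGraph.exists_height_eq_add (h : IsTopologicalGraph X) :
    height (X ≃ₜ X) (univ : Set X) < ⊤ ∧
    ∀ k : ℕ, ∃ G : Subgroup (X ≃ₜ X), height G (univ : Set X) =
      height (X ≃ₜ X) (univ : Set X) + k := by
  have := h.connectedSpace
  have := h.metrizableSpace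
  have hinf := h.infinite
  obtain ⟨V₀, E₀, D₀⟩ := h.exists_isDecomp
  obtain ⟨V, E, D, hcase⟩ := D₀.exists_normal_form
  have hE : E.Nonempty := by
    by_contra hE
    have h1 := D.sUnion_eq
    rw [Set.not_nonempty_iff_eq_empty.1 hE, sUnion_empty] at h1
    have h2 : V = univ := by rw [← compl_compl V, ← h1, compl_empty]
    exact infinite_univ (h2 ▸ D.finite_vertices)
  obtain ⟨hcard, hadd⟩ := D.exists_height_eq_add hE
  have hlt : height (preserving (X := X) (· ∈ V)) (univ : Set X) < ⊤ := by
    refine lt_top_iff_ne_top.2 fun ht => ?_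
    rw [ht, top_add] at hcard
    exact ENat.natCast_ne_top _ hcard.symm
  rcases hcase with hsing | ⟨v, e, ψ, rfl, rfl, hψ⟩
  -- Here `V` is exactly the set of points without a line neighbourhood. This set is topologically
  -- invariant, so `K` is the full homeomorphism group.
  · have hVl : ∀ x, x ∈ V ↔ ¬ IsLinePoint x := by
      refine fun x => ⟨hsing x, fun hx => ?_⟩
      by_contra hxV
      obtain ⟨e, he, hxe⟩ := (D.mem_or x).resolve_left hxV
      obtain ⟨ψ, a, b, hψ⟩ := D.exists_param e he
      rw [← hψ.range_eq] at hxe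
      obtain ⟨t, rfl⟩ := hxe
      refine hx ⟨fun s => ψ (s + t), ?_, by simp⟩
      exact (D.isOpenEmbedding he hψ).comp (Homeomorph.addRight t).isOpenEmbedding
    have hpres : ∀ f : X ≃ₜ X, f ∈ preserving (X := X) (· ∈ V) := by
      intro f x
      refine propext ?_
      change f x ∈ V ↔ x ∈ V
      rw [hVl, hVl, not_iff_not]
      refine ⟨fun hx => ?_, fun hx => hx.map f⟩
      simpa using hx.map f.symm
    have heq : height (X ≃ₜ X) (univ : Set X) =
        height (preserving (X := X) (· ∈ V)) (univ : Set X) :=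
      height_congr (fun g => ⟨⟨g, hpres g⟩, fun _ => rfl⟩) (fun k => ⟨k.1, fun _ => rfl⟩) _
    rw [heq]
    exact ⟨hlt, hadd⟩
  -- In the circle case the vertex is an arbitrary choice, and the full group has a single orbit.
  · have horb : ∀ x y : X, x ∈ MulAction.orbit (X ≃ₜ X) y := by
      intro x y
      obtain ⟨f, hf⟩ := exists_homeomorph_of_loop D hψ y x
      exact ⟨f, hf⟩
    have hsub : Subsingleton (MulAction.orbitRel.Quotient (X ≃ₜ X) X) := by
      refine ⟨fun p q => ?_⟩
      obtain ⟨x, rfl⟩ := Quotient.mk_surjective p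
      obtain ⟨y, rfl⟩ := Quotient.mk_surjective q
      exact Quotient.sound (horb x y)
    have hne : Nonempty (MulAction.orbitRel.Quotient (X ≃ₜ X) X) := ⟨Quotient.mk _ v⟩
    have h0 : height (X ≃ₜ X) (univ : Set X) = 0 := by
      have := height_add_one_eq_card (G := X ≃ₜ X) (X := X) fun x y hxy => absurd (horb x y) hxy
      rw [Nat.card_eq_one_iff_unique.2 ⟨hsub, hne⟩, Nat.cast_one] at this
      simpa using this
    have h1 : height (preserving (X := X) (· ∈ ({v} : Set X))) (univ : Set X) = 1 := by
      have hve : ψ 0 ≠ v := fun h => D.notMem_vertices rfl (hψ.mem 0) h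
      have h2 : Nat.card (MulAction.orbitRel.Quotient
          (preserving (X := X) (· ∈ ({v} : Set X))) X) = 2 := by
        refine Nat.card_eq_two_iff.2 ⟨Quotient.mk _ v, Quotient.mk _ (ψ 0), fun h => ?_, ?_⟩
        · obtain ⟨f, hf, hfv⟩ := mem_orbit_preserving.1 (Quotient.exact h.symm)
          exact hve (hfv ▸ (mem_preserving.1 hf v).mpr rfl)
        · refine eq_univ_of_forall fun q => ?_
          obtain ⟨x, rfl⟩ := Quotient.mk_surjective q
          rcases D.mem_or x with rfl | ⟨e', rfl, hx⟩
          · exact Or.inl rfl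
          · exact Or.inr (Quotient.sound (mem_orbit_preserving.2
              (D.exists_preserving_of_mem_edge rfl (hψ.mem 0) hx)))
      rw [h2] at hcard
      exact (ENat.add_left_injective_of_ne_top ENat.one_ne_top) (hcard.trans (by norm_num))
    rw [h0]
    refine ⟨WithTop.top_pos, fun k => ?_⟩
    -- The stabilizer of the vertex already has height `1`, so height `0` needs the full group and
    -- height `k + 1` is obtained by adding `k` to that of the stabilizer.
    rcases k with _ | k
    · refine ⟨⊤, ?_⟩
      rw [Nat.cast_zero, add_zero, ← h0]
      exact height_congr (fun g => ⟨g.1, fun _ => rfl⟩)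
        (fun k => ⟨⟨k, Subgroup.mem_top k⟩, fun _ => rfl⟩) _
    · obtain ⟨G, hG⟩ := hadd k
      refine ⟨G, ?_⟩
      rw [hG, h1]
      push_cast
      ring

end TransformationGroup

theorem mainTheorem2 {X : Type*} [TopologicalSpace X]
    (hX : TransformationGroup.IsTopologicalGraph X) :
    TransformationGroup.height (X ≃ₜ X) (Set.univ : Set X) < ⊤ ∧
    TransformationGroup.possibleHeights X =
      {h : ℕ∞ | ∃ k : ℕ, h = TransformationGroup.height (X ≃ₜ X) (Set.univ : Set X) + k} ∪
        {⊤} := by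
  open TransformationGroup in
  obtain ⟨hlt, hadd⟩ := hX.exists_height_eq_add
  refine ⟨hlt, Set.Subset.antisymm ?_ ?_⟩
  · intro h hh
    obtain ⟨G, rfl⟩ := mem_possibleHeights_iff.1 hh
    have hle : height (X ≃ₜ X) (Set.univ : Set X) ≤ height G (Set.univ : Set X) :=
      height_le_height (fun g => ⟨g.1, fun _ => rfl⟩) _
    by_cases htop : height G (Set.univ : Set X) = ⊤
    · exact Or.inr htop
    · obtain ⟨c, hc⟩ := exists_add_of_le hle
      have hc' : c ≠ ⊤ := by
        rintro rfl
        exact htop (by rw [hc, add_top])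
      lift c to ℕ using hc'
      exact Or.inl ⟨c, hc⟩
  · rintro h (⟨k, rfl⟩ | rfl)
    · obtain ⟨G, hG⟩ := hadd k
      exact mem_possibleHeights_iff.2 ⟨G, hG.symm⟩
    · have := hX.infinite
      have := hX.metrizableSpace
      refine mem_possibleHeights_iff.2 ⟨⊥, (height_eq_top_of_trivial fun g x => ?_).symm⟩
      obtain rfl : g = 1 := Subsingleton.elim _ _
      exact one_smul _ x
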